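/- Notation. For $a\in\mathbb{R}^N$ and $\vec z\in\mathbb{C}^N$ let $$\mathcal{B}_{a}(\vec z)=\frac{\det\left[e^{z_i a_j}\right]_{i,j=1}^N}{\prod_{1\le i<j\le N}(z_i-z_j)},\qquad \rho_N=(N-1,N-2,\ldots,0).$$ The normalized function $\mathcal{B}_a(\vec z)/\mathcal{B}_a(\rho_N)$ is given by this formula when the coordinates of $a$ and those of $\vec z$ are pairwise distinct, and is extended by continuity to all $(a,\vec z)\in\mathbb{R}^N\times\mathbb{C}^N$. For a random matrix $X$ in $\mathsf{GL}(N,\mathbb{C})$ with squared singular values $\vec x=(x_1\ge\cdots\ge x_N)$, its multivariate Bessel generating function is $$\Phi_X(\vec z)=\mathbb{E}\left[\frac{\mathcal{B}_{\log\vec x}(\vec z)}{\mathcal{B}_{\log\vec x}(\rho_N)}\right].$$ For $c\in\mathbb{C}$ let $$\mathcal{D}_c=\sum_{i=1}^N\left(\prod_{j\ne i}\frac{c+z_i-z_j}{z_i-z_j}\right)\mathcal{T}_{c,z_i},\qquad \mathcal{T}_{c,z_i}f(z_1,\ldots,z_N)=f(z_1,\ldots,z_i+c,\ldots,z_N).$$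 For $f$ symmetric and entire, the singularities of $\mathcal{D}_cf$ on $\{z_i=z_j\}$ are removable, and $\mathcal{D}_cf$ denotes the resulting extension by continuity to $\mathbb{C}^N$. Proposition. Let $X(1),X(2),\ldots$ be independent, almost surely nonsingular, complex random $N\times N$ matrices with right unitarily invariant distributions (that is, $X(m)U$ and $X(m)$ have the same distribution for every $U\in\mathsf{U}(N)$), and let $\varphi_m=\Phi_{X(m)}$. Assume that, for every $m\ge1$, the expectation defining $\varphi_m(\vec z)$ exists for every $\vec z\in\mathbb{C}^N$ and that $\varphi_m$ is analytic on $\mathbb{C}^N$. Fix real numbers $c_1,\ldots,c_k>0$ and integers $M_1\ge\cdots\ge M_k>M_{k+1}=0$, and let $y_1(M)\ge\cdots\ge y_N(M)$ be the squared singular values of $X(M)X(M-1)\cdots X(1)$. Then the random variable $\prod_{i=1}^k\sum_{j=1}^N y_j(M_i)^{c_i}$ is integrable, and $$\mathbb{E}\left[\prod_{i=1}^k\sum_{j=1}^N y_j(M_i)^{c_i}\right]=\left.\mathcal{D}_{c_1}\prod_{m_1=M_2+1}^{M_1}\varphi_{m_1}(\vec z)\;\mathcal{D}_{c_2}\prod_{m_2=M_3+1}^{M_2}\varphi_{m_2}(\vec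 z)\cdots\mathcal{D}_{c_k}\prod_{m_k=M_{k+1}+1}^{M_k}\varphi_{m_k}(\vec z)\right|_{\vec z=\rho_N},$$ where each operator $\mathcal{D}_{c_i}$ acts on everything to its right. -/

import Mathlib

open MeasureTheory ProbabilityTheory

noncomputable section

namespace RMP

/-- The entrywise (that is, Borel) sigma-algebra on complex `N × N` matrices. -/
instance instMeasurableSpaceMatrix {N : ℕ} :
    MeasurableSpace (Matrix (Fin N) (Fin N) ℂ) :=
  MeasurableSpace.pi

/-- `Δ(z) = ∏_{i < j} (z_i - z_j)`. -/
def vandermonde {N : ℕ} (z : Fin N → ℂ) : ℂ :=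
  ∏ i, ∏ j ∈ Finset.Ioi i, (z i - z j)

/-- The multivariate Bessel function `𝓑_a(z) = det[exp(z_i a_j)] / Δ(z)`, for `z` with pairwise
distinct coordinates. -/
def multivariateBessel {N : ℕ} (a : Fin N → ℝ) (z : Fin N → ℂ) : ℂ :=
  (Matrix.of fun i j : Fin N => Complex.exp (z i * (a j : ℂ))).det / vandermonde z

/-- `ρ_N = (N - 1, N - 2, …, 0)`. -/
def rho (N : ℕ) : Fin N → ℂ := fun i => (N : ℂ) - 1 - ((i : ℕ) : ℂ)

/-- The normalized multivariate Bessel function `𝓑_a(z) / 𝓑_a(ρ_N)`, for all real `a` and all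
complex `z`. Where both `a` and `z` have pairwise distinct coordinates it is this quotient; its
singularities at the remaining points (`0 / 0`) are removable, and its values there are the
limits. -/
def normalizedBessel {N : ℕ} (a : Fin N → ℝ) (z : Fin N → ℂ) : ℂ :=
  extendFrom
    {p : (Fin N → ℝ) × (Fin N → ℂ) | Function.Injective p.1 ∧ Function.Injective p.2}
    (fun p => multivariateBessel p.1 p.2 / multivariateBessel p.1 (rho N)) (a, z)

/-- The squared singular values of a square matrix, in weakly decreasing order. -/
def sqSingularValues {N : ℕ} (A : Matrix (Fin N) (Fin N) ℂ) : Fin N → ℝ :=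
  fun j => (Matrix.toEuclideanLin A).singularValues (j : ℕ) ^ 2

/-- The random variable `𝓑_{log x}(z) / 𝓑_{log x}(ρ_N)`, where `x` are the squared singular
values of the matrix `A`. -/
def besselOfMatrix {N : ℕ} (z : Fin N → ℂ) (A : Matrix (Fin N) (Fin N) ℂ) : ℂ :=
  normalizedBessel (fun j => Real.log (sqSingularValues A j)) z

/-- The multivariate Bessel generating function `Φ_X(z) = 𝔼[𝓑_{log x}(z) / 𝓑_{log x}(ρ_N)]` of a
random matrix `X` with squared singular values `x`. -/
def besselGenFun {Ω : Type*} [MeasurableSpace Ω] (P : Measure Ω) {N : ℕ}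
    (X : Ω → Matrix (Fin N) (Fin N) ℂ) (z : Fin N → ℂ) : ℂ :=
  ∫ ω, besselOfMatrix z (X ω) ∂P

/-- The law of `X U` is the law of `X`, for every unitary `U`. -/
def RightUnitarilyInvariant {Ω : Type*} [MeasurableSpace Ω] (P : Measure Ω) {N : ℕ}
    (X : Ω → Matrix (Fin N) (Fin N) ℂ) : Prop :=
  ∀ U ∈ Matrix.unitaryGroup (Fin N) ℂ, P.map (fun ω => X ω * U) = P.map X

/-- `X(M) ⋯ X(1)`. -/
def matProd {N : ℕ} (X : ℕ → Matrix (Fin N) (Fin N) ℂ) : ℕ → Matrix (Fin N) (Fin N) ℂ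
  | 0 => 1
  | M + 1 => X (M + 1) * matProd X M

/-- The difference operator `𝓓_c = ∑_i (∏_{j ≠ i} (c + z_i - z_j) / (z_i - z_j)) 𝓣_{c, z_i}`, where
`𝓣_{c, z_i}` adds `c` to the `i`-th coordinate. The formula is used where the `z_i` are pairwise
distinct; for `f` symmetric and entire its singularities at the remaining points are removable,
and the values there are the limits. -/
def diffOp {N : ℕ} (c : ℂ) (f : (Fin N → ℂ) → ℂ) : (Fin N → ℂ) → ℂ :=
  extendFrom {z : Fin N → ℂ | Function.Injective z}
    (fun z => ∑ i, (∏ j ∈ Finset.univ.erase i, (c + z i - z j) / (z i - z j)) *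
      f (Function.update z i (z i + c)))

/-- `𝓓_{c_1} g_1 𝓓_{c_2} g_2 ⋯ 𝓓_{c_k} g_k`, every operator acting on everything to its right. -/
def nestedDiffOp {N : ℕ} : (k : ℕ) → (Fin k → ℂ) → (Fin k → (Fin N → ℂ) → ℂ) →
    (Fin N → ℂ) → ℂ
  | 0, _, _ => 1
  | k + 1, c, g => diffOp (c 0) (g 0 * nestedDiffOp k (Fin.tail c) (Fin.tail g))

end RMP

end

noncomputable section

namespace RMP
open Matrix
open scoped ComplexOrder

/-! ### Haar measure on the unitary group -/

/-! The normalized Bessel functions are the spherical functions of `GL(N, ℂ)`. For positive definite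
`A`, `minorPow` raises `det A` to the power `z 0` and the trailing minor starting at row `i ≥ 1` to
the power `z i - z (i-1) - 1`; its average over unitary conjugates is `sph`. The Gelfand-Naimark
formula (`sph_diagonal_exp`, `besselOfMatrix_eq_sph`) identifies `sph (Aᴴ * A) z` with the
normalized Bessel function at the logarithms of the squared singular values of `A`. Two properties
of these functions then carry the theorem.

Multiplicativity: averaging `sph` at `g k h` over unitary `k` gives the product of the values at `g`
and at `h` (`integral_sph_mul`), because `minorPow` is a character on triangular matrices and every
invertible matrix is unitary times triangular. The newest factor `X (m+1)` is right invariant and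
independent of the past, so appending it multiplies the expectation of `H * sph` by the generating
function of `X (m+1)`, for every weight `H` determined by the past (`IsMoment.succ`).

Eigenrelation: `𝓓_c` is the sum of the coordinate shifts conjugated by the Vandermonde product, and
that sum multiplies `det [exp(z_i a_j)]` by `∑ exp(c a_j)`. Hence `𝓓_c` multiplies the spherical
function by the power sum of the squared singular values, and applying it to an expectation inserts
this power sum into the weight (`IsMoment.diffOp`). Reading the operator word from right to left
builds up the whole product of power sums, and at `ρ_N` the spherical function equals 1.

Exchanging expectations and operators rests on positivity: real parameters give positive spherical
functions, which dominate those with the same real part, and on a box of parameters the finitely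
many vertices dominate everything. So the expectations are continuous in `z`, and their values at
coinciding coordinates are the limits that define `𝓓_c` there.

Gelfand-Naimark is proved by induction on the size. The eigenvalues of a corner of a Haar-random
conjugate of `diag x` interlace with `x` and have density proportional to their Vandermonde
determinant. This follows from the uniform direction of a Haar column and a Jacobian computation
(`exists_integral_haarU_eq_integral_interlacingBox`). -/

instance instBorelSpaceMatrix {N : ℕ} : BorelSpace (Matrix (Fin N) (Fin N) ℂ) :=
  inferInstanceAs (BorelSpace (Fin N → Fin N → ℂ))

instance instSecondCountableMatrix {N : ℕ} :
    SecondCountableTopology (Matrix (Fin N) (Fin N) ℂ) :=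
  inferInstanceAs (SecondCountableTopology (Fin N → Fin N → ℂ))

instance instCompactSpaceUnitary {N : ℕ} : CompactSpace (unitaryGroup (Fin N) ℂ) := by
  suffices h : IsCompact ((unitaryGroup (Fin N) ℂ : Submonoid (Matrix (Fin N) (Fin N) ℂ)) :
      Set (Matrix (Fin N) (Fin N) ℂ)) from isCompact_iff_compactSpace.1 h
  have hc : IsCompact (Set.univ.pi fun _ : Fin N => Set.univ.pi fun _ : Fin N =>
      Metric.closedBall (0 : ℂ) 1) :=
    isCompact_univ_pi fun _ => isCompact_univ_pi fun _ => isCompact_closedBall 0 1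
  refine IsCompact.of_isClosed_subset hc ?_ ?_
  · exact isClosed_unitary (R := Matrix (Fin N) (Fin N) ℂ)
  · intro U hU i _ j _
    simpa using entry_norm_bound_of_unitary hU i j

instance instSecondCountableUnitary {N : ℕ} :
    SecondCountableTopology (unitaryGroup (Fin N) ℂ) :=
  TopologicalSpace.Subtype.secondCountableTopology
    ((unitaryGroup (Fin N) ℂ : Submonoid (Matrix (Fin N) (Fin N) ℂ)) :
      Set (Matrix (Fin N) (Fin N) ℂ))

/-- The Haar probability measure on the unitary group. -/
def haarU (N : ℕ) : Measure (unitaryGroup (Fin N) ℂ) := Measure.haarMeasure ⊤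

instance (N : ℕ) : (haarU N).IsHaarMeasure := by unfold haarU; infer_instance

instance (N : ℕ) : IsProbabilityMeasure (haarU N) :=
  ⟨by simpa [haarU] using Measure.haarMeasure_self (K₀ := (⊤ :
    TopologicalSpace.PositiveCompacts (unitaryGroup (Fin N) ℂ)))⟩

/-- Compact groups are unimodular: a right translate of the Haar probability measure is again one,
and there is only one. -/
instance (N : ℕ) : (haarU N).IsMulRightInvariant := by
  refine ⟨fun g => ?_⟩
  have : (Measure.map (· * g) (haarU N)).IsHaarMeasure :=
    Measure.isHaarMeasure_map_mul_right _ g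
  have : IsProbabilityMeasure (Measure.map (· * g) (haarU N)) :=
    Measure.isProbabilityMeasure_map (measurable_mul_const g).aemeasurable
  exact Measure.isHaarMeasure_eq_of_isProbabilityMeasure _ _

/-! ### Power functions of trailing principal minors -/

/-- The product of complex powers of the trailing principal minors of a positive definite
matrix. -/
def minorPow : (n : ℕ) → Matrix (Fin n) (Fin n) ℂ → (Fin n → ℂ) → ℂ
  | 0, _, _ => 1
  | n + 1, A, z => Complex.exp (z 0 * (Real.log A.det.re : ℂ)) *
      minorPow n (A.submatrix Fin.succ Fin.succ) (fun i => z i.succ - z 0 - 1)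

/-- Once the logarithms of the minors are frozen, the dependence on `z` is the exponential of a real
affine form. All norm estimates come from this. -/
theorem minorPow_eq_exp : ∀ (n : ℕ) (A : Matrix (Fin n) (Fin n) ℂ),
    ∃ (t : Fin n → ℝ) (s : ℝ), ∀ z : Fin n → ℂ,
      minorPow n A z = Complex.exp (∑ i, z i * (t i : ℂ) + (s : ℂ))
  | 0, A => ⟨0, 0, fun z => by simp [minorPow]⟩
  | n + 1, A => by
    obtain ⟨t, s, h⟩ := minorPow_eq_exp n (A.submatrix Fin.succ Fin.succ)
    -- Each shifted exponent `z i.succ - z 0 - 1` takes `t i` off the coefficient of `z 0` and off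
    -- the constant.
    refine ⟨Fin.cons (Real.log A.det.re - ∑ i, t i) t, s - ∑ i, t i, fun z => ?_⟩
    rw [minorPow, h, ← Complex.exp_add]
    congr 1
    simp only [Fin.sum_univ_succ, Fin.cons_zero, Fin.cons_succ, sub_mul, Finset.sum_sub_distrib,
      ← Finset.mul_sum]
    push_cast
    ring

theorem norm_minorPow (n : ℕ) (A : Matrix (Fin n) (Fin n) ℂ) (z : Fin n → ℂ) :
    ((‖minorPow n A z‖ : ℝ) : ℂ) = minorPow n A (fun i => ((z i).re : ℂ)) := by
  obtain ⟨t, s, h⟩ := minorPow_eq_exp n A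
  rw [h, h, Complex.norm_exp, Complex.ofReal_exp]
  congr 1
  simp [Complex.add_re, Complex.re_sum, Complex.mul_re]

/-- On an interval `exp (y * t)` is at most the sum of its two endpoint values; expanding the
product of these sums gives one term per vertex of the box. This supplies an integrable bound that
is uniform near a given parameter. -/
theorem norm_minorPow_le_sum (n : ℕ) (A : Matrix (Fin n) (Fin n) ℂ) (l u : Fin n → ℝ)
    (z : Fin n → ℂ) (hl : ∀ i, l i ≤ (z i).re) (hu : ∀ i, (z i).re ≤ u i) :
    ‖minorPow n A z‖ ≤ ∑ v : Fin n → Bool,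
      ‖minorPow n A (fun i => ((if v i then l i else u i : ℝ) : ℂ))‖ := by
  obtain ⟨t, s, h⟩ := minorPow_eq_exp n A
  have key : ∀ w : Fin n → ℂ, ‖minorPow n A w‖ = (∏ i, Real.exp ((w i).re * t i)) * Real.exp s := by
    intro w
    rw [h, Complex.norm_exp, ← Real.exp_sum, ← Real.exp_add]
    simp [Complex.add_re, Complex.re_sum, Complex.mul_re]
  simp only [key, Complex.ofReal_re]
  rw [← Finset.sum_mul]
  gcongr
  calc ∏ i, Real.exp ((z i).re * t i)
      ≤ ∏ i, ∑ b : Bool, Real.exp ((if b then l i else u i) * t i) := by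
        refine Finset.prod_le_prod (fun i _ => (Real.exp_pos _).le) fun i _ => ?_
        simp only [Fintype.sum_bool, if_true, Bool.false_eq_true, if_false]
        rcases le_total 0 (t i) with ht | ht
        · have := Real.exp_le_exp.2 (mul_le_mul_of_nonneg_right (hu i) ht)
          linarith [Real.exp_pos (l i * t i)]
        · have := Real.exp_le_exp.2 (mul_le_mul_of_nonpos_right (hl i) ht)
          linarith [Real.exp_pos (u i * t i)]
    _ = _ := by
        rw [Finset.prod_univ_sum, Fintype.piFinset_univ]

theorem measurable_minorPow : ∀ (n : ℕ) (z : Fin n → ℂ),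
    Measurable (fun A : Matrix (Fin n) (Fin n) ℂ => minorPow n A z)
  | 0, z => by simp [minorPow]
  | n + 1, z => by
    simp only [minorPow]
    have h1 : Measurable fun A : Matrix (Fin (n + 1)) (Fin (n + 1)) ℂ => A.det.re :=
      (Complex.continuous_re.comp (continuous_id.matrix_det)).measurable
    have h2 : Measurable fun A : Matrix (Fin (n + 1)) (Fin (n + 1)) ℂ =>
        A.submatrix Fin.succ Fin.succ := (continuous_id.matrix_submatrix _ _).measurable
    refine Measurable.mul (Complex.measurable_exp.comp (measurable_const.mul
      (Complex.measurable_ofReal.comp (Real.measurable_log.comp h1)))) ?_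
    exact (measurable_minorPow n _).comp h2

theorem continuous_minorPow {Y : Type*} [TopologicalSpace Y] : ∀ (n : ℕ)
    (A : Y → Matrix (Fin n) (Fin n) ℂ) (z : Y → Fin n → ℂ), Continuous A → Continuous z →
    (∀ y, (A y).PosDef) → Continuous fun y => minorPow n (A y) (z y)
  | 0, A, z, _, _, _ => by simpa [minorPow] using continuous_const
  | n + 1, A, z, hA, hz, hp => by
    simp only [minorPow]
    have h1 : Continuous fun y => Real.log (A y).det.re := by
      refine Continuous.log (Complex.continuous_re.comp hA.matrix_det) fun y => ?_
      exact ((Complex.lt_def.1 (hp y).det_pos).1).ne'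
    refine Continuous.mul (by fun_prop) ?_
    exact continuous_minorPow n _ _ (hA.matrix_submatrix _ _) (by fun_prop)
      fun y => (hp y).submatrix (Fin.succ_injective n)

theorem det_conjTranspose_mul_mul (n : ℕ) (A B : Matrix (Fin n) (Fin n) ℂ) :
    (Bᴴ * A * B).det = (‖B.det‖ ^ 2 : ℝ) * A.det := by
  rw [det_mul, det_mul, det_conjTranspose, mul_assoc, mul_comm, mul_assoc, Complex.star_def]
  rw [Complex.mul_conj, Complex.normSq_eq_norm_sq, mul_comm]

/-- The first row of a lower triangular `B` vanishes off the diagonal, so conjugation by `B`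
commutes with passing to trailing corners. Each minor is therefore multiplied by a squared modulus
that does not depend on `A`. -/
theorem minorPow_conj : ∀ (n : ℕ) (A B : Matrix (Fin n) (Fin n) ℂ) (z : Fin n → ℂ),
    A.PosDef → IsUnit B → (∀ i j, i < j → B i j = 0) →
    minorPow n (Bᴴ * A * B) z = minorPow n A z * minorPow n (Bᴴ * B) z
  | 0, A, B, z, _, _, _ => by simp [minorPow]
  | n + 1, A, B, z, hA, hB, hl => by
    have hdB : B.det ≠ 0 := ((isUnit_iff_isUnit_det _).1 hB).ne_zero
    set B' := B.submatrix Fin.succ Fin.succ with hB'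
    have hsub : ∀ C : Matrix (Fin (n + 1)) (Fin (n + 1)) ℂ,
        (Bᴴ * C * B).submatrix Fin.succ Fin.succ
          = B'ᴴ * C.submatrix Fin.succ Fin.succ * B' := by
      intro C
      ext i j
      simp [mul_apply, Fin.sum_univ_succ, hl 0 _ (Fin.succ_pos _), hB']
    have hdet : B.det = B 0 0 * B'.det := by
      rw [det_succ_row_zero, Fin.sum_univ_succ]
      simp [hl 0 _ (Fin.succ_pos _), hB', Fin.succAbove_zero]
    have hB'u : IsUnit B' := by
      rw [isUnit_iff_isUnit_det, isUnit_iff_ne_zero]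
      intro h
      exact hdB (by rw [hdet, h, mul_zero])
    have hl' : ∀ i j, i < j → B' i j = 0 := fun i j h => hl _ _ (Fin.succ_lt_succ_iff.2 h)
    have hA' := hA.submatrix (Fin.succ_injective n)
    have hd : 0 < A.det.re := (Complex.lt_def.1 hA.det_pos).1
    have h1 : (Bᴴ * B) = Bᴴ * 1 * B := by rw [mul_one]
    rw [minorPow, hsub, minorPow_conj n _ B' _ hA' hB'u hl', minorPow, h1, minorPow, hsub,
      det_conjTranspose_mul_mul, det_conjTranspose_mul_mul, submatrix_one _ (Fin.succ_injective n),
      mul_one B'ᴴ, Complex.re_ofReal_mul, Complex.re_ofReal_mul, det_one, Complex.one_re, mul_one,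
      Real.log_mul (by positivity) hd.ne']
    push_cast
    rw [mul_add, Complex.exp_add]
    ring

theorem minorPow_one : ∀ (n : ℕ) (z : Fin n → ℂ), minorPow n 1 z = 1
  | 0, z => rfl
  | n + 1, z => by
    rw [minorPow, submatrix_one _ (Fin.succ_injective n), minorPow_one n]; simp

/-- A positive definite matrix becomes the identity under a triangular change of basis. -/
theorem exists_triangular_conj_eq_one {ι : Type*} [Fintype ι] [LinearOrder ι]
    [LocallyFiniteOrderBot ι] {A : Matrix ι ι ℂ} (hA : A.PosDef) :
    ∃ B : Matrix ι ι ℂ, IsUnit B ∧ (∀ i j, j < i → B i j = 0) ∧ Bᴴ * A * B = 1 := by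
  set M := LDL.lowerInv hA
  have hMu : IsUnit M := by
    have := LDL.invertibleLowerInv hA
    exact isUnit_of_invertible (LDL.lowerInv hA)
  set d := LDL.diagEntries hA
  have hD : M * A * Mᴴ = diagonal d := (LDL.diag_eq_lowerInv_conj hA).symm
  have hpd : (diagonal d).PosDef := by
    rw [← hD]
    have : M * A * Mᴴ = (Mᴴ)ᴴ * A * Mᴴ := by rw [conjTranspose_conjTranspose]
    rw [this]
    exact hA.conjTranspose_mul_mul_same (mulVec_injective_iff_isUnit.2 (by
      exact (isUnit_conjTranspose _).2 hMu))
  have hd : ∀ i, 0 < d i := by simpa using hpd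
  -- `e` is the inverse square root of the diagonal part; rescaling by it turns `M * A * Mᴴ =
  -- diagonal d` into the identity.
  let e : ι → ℂ := fun i => (((Real.sqrt (d i).re)⁻¹ : ℝ) : ℂ)
  have hre : ∀ i, 0 < (d i).re := fun i => (Complex.lt_def.1 (hd i)).1
  have hde : ∀ i, d i = ((d i).re : ℂ) := fun i => by
    apply Complex.ext <;> simp [← (Complex.lt_def.1 (hd i)).2]
  refine ⟨Mᴴ * diagonal e, ?_, ?_, ?_⟩
  · refine ((isUnit_conjTranspose _).2 hMu).mul ?_
    rw [isUnit_iff_isUnit_det, det_diagonal, isUnit_iff_ne_zero, Finset.prod_ne_zero_iff]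
    intro i _
    have := Real.sqrt_pos.2 (hre i)
    exact Complex.ofReal_ne_zero.2 (inv_ne_zero this.ne')
  · intro i j h
    simp [mul_diagonal, M, LDL.lowerInv_triangular hA h]
  · have he : (diagonal e)ᴴ = diagonal e := by
      rw [diagonal_conjTranspose]; congr 1; ext i; simp [e]
    rw [conjTranspose_mul, conjTranspose_conjTranspose, he]
    calc diagonal e * M * A * (Mᴴ * diagonal e) = diagonal e * (M * A * Mᴴ) * diagonal e := by
          simp only [Matrix.mul_assoc]
      _ = 1 := by
          rw [hD, diagonal_mul_diagonal, diagonal_mul_diagonal, ← diagonal_one]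
          congr 1; ext i
          rw [hde i]
          have := Real.sqrt_pos.2 (hre i)
          simp only [e, ← Complex.ofReal_mul]
          norm_cast
          nth_rewrite 2 [← Real.mul_self_sqrt (hre i).le]
          field_simp

/-- Reverse Cholesky decomposition. -/
theorem exists_lowerTriangular_conj_eq_one {n : ℕ} {A : Matrix (Fin n) (Fin n) ℂ}
    (hA : A.PosDef) : ∃ B : Matrix (Fin n) (Fin n) ℂ, IsUnit B ∧ (∀ i j, i < j → B i j = 0) ∧
      Bᴴ * A * B = 1 := by
  -- Reversing the order of the indices exchanges upper and lower triangular matrices.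
  have hS := hA.submatrix (OrderDual.ofDual (α := Fin n)).injective
  obtain ⟨B, hB, hl, h⟩ := exists_triangular_conj_eq_one hS
  have h2 : (B.submatrix OrderDual.toDual OrderDual.toDual)ᴴ * A *
      B.submatrix OrderDual.toDual OrderDual.toDual = 1 := by
    have := congrArg (fun C => C.submatrix (OrderDual.toDual (α := Fin n))
      (OrderDual.toDual (α := Fin n))) h
    simpa [← submatrix_mul_equiv _ _ _ (OrderDual.toDual (α := Fin n)),
      submatrix_submatrix] using this
  exact ⟨B.submatrix OrderDual.toDual OrderDual.toDual,
    (isUnit_submatrix_equiv (OrderDual.toDual (α := Fin n)) (OrderDual.toDual (α := Fin n))).2 hB,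
    fun i j hij => hl _ _ (OrderDual.toDual_lt_toDual.2 hij), h2⟩

end RMP

end

noncomputable section

namespace RMP
open Matrix
open scoped ComplexOrder

/-! ### Spherical functions -/

/-- The average of `minorPow` over a unitary conjugacy orbit. -/
def sph {n : ℕ} (C : Matrix (Fin n) (Fin n) ℂ) (z : Fin n → ℂ) : ℂ :=
  ∫ k : unitaryGroup (Fin n) ℂ, minorPow n ((k : Matrix (Fin n) (Fin n) ℂ)ᴴ * C * k) z ∂haarU n

theorem isUnit_unitary {n : ℕ} (k : unitaryGroup (Fin n) ℂ) :
    IsUnit (k : Matrix (Fin n) (Fin n) ℂ) := (Group.isUnit k).map (unitaryGroup (Fin n) ℂ).subtype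

theorem conjTranspose_mul_unitary {n : ℕ} (k : unitaryGroup (Fin n) ℂ) :
    (k : Matrix (Fin n) (Fin n) ℂ)ᴴ * k = 1 := by
  simpa [star_eq_conjTranspose] using mem_unitaryGroup_iff'.1 k.2

theorem posDef_conj_of_isUnit {n : ℕ} {C B : Matrix (Fin n) (Fin n) ℂ} (hC : C.PosDef)
    (hB : IsUnit B) : (Bᴴ * C * B).PosDef :=
  hC.conjTranspose_mul_mul_same (mulVec_injective_iff_isUnit.2 hB)

theorem posDef_gram {n : ℕ} {B : Matrix (Fin n) (Fin n) ℂ} (hB : IsUnit B) : (Bᴴ * B).PosDef := by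
  simpa using posDef_conj_of_isUnit PosDef.one hB

theorem measurable_conj_unitary {n : ℕ} : Measurable
    fun p : Matrix (Fin n) (Fin n) ℂ × unitaryGroup (Fin n) ℂ =>
      (p.2 : Matrix (Fin n) (Fin n) ℂ)ᴴ * p.1 * p.2 := by
  have : Continuous fun p : Matrix (Fin n) (Fin n) ℂ × unitaryGroup (Fin n) ℂ =>
      (p.2 : Matrix (Fin n) (Fin n) ℂ)ᴴ * p.1 * p.2 := by fun_prop
  exact this.measurable

theorem stronglyMeasurable_sph {n : ℕ} (z : Fin n → ℂ) :
    StronglyMeasurable fun C : Matrix (Fin n) (Fin n) ℂ => sph C z := by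
  have : StronglyMeasurable fun p : Matrix (Fin n) (Fin n) ℂ × unitaryGroup (Fin n) ℂ =>
      minorPow n ((p.2 : Matrix (Fin n) (Fin n) ℂ)ᴴ * p.1 * p.2) z :=
    ((measurable_minorPow n z).comp measurable_conj_unitary).stronglyMeasurable
  exact this.integral_prod_right

theorem continuous_minorPow_conj {n : ℕ} {C : Matrix (Fin n) (Fin n) ℂ} (hC : C.PosDef)
    (z : Fin n → ℂ) : Continuous fun k : unitaryGroup (Fin n) ℂ =>
      minorPow n ((k : Matrix (Fin n) (Fin n) ℂ)ᴴ * C * k) z :=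
  continuous_minorPow n _ _ (by fun_prop) continuous_const
    fun k => posDef_conj_of_isUnit hC (isUnit_unitary k)

theorem integrable_of_continuous_haarU {n : ℕ} {E : Type*} [NormedAddCommGroup E]
    {f : unitaryGroup (Fin n) ℂ → E} (hf : Continuous f) : Integrable f (haarU n) := by
  rw [← integrableOn_univ]
  exact hf.continuousOn.integrableOn_compact isCompact_univ

theorem integrable_minorPow_conj {n : ℕ} {C : Matrix (Fin n) (Fin n) ℂ} (hC : C.PosDef)
    (z : Fin n → ℂ) : Integrable (fun k : unitaryGroup (Fin n) ℂ =>
      minorPow n ((k : Matrix (Fin n) (Fin n) ℂ)ᴴ * C * k) z) (haarU n) :=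
  integrable_of_continuous_haarU (continuous_minorPow_conj hC z)

theorem continuous_sph {n : ℕ} {Y : Type*} [TopologicalSpace Y] [FirstCountableTopology Y]
    [LocallyCompactSpace Y]
    {A : Y → Matrix (Fin n) (Fin n) ℂ} {z : Y → Fin n → ℂ} (hA : Continuous A)
    (hz : Continuous z) (hp : ∀ y, (A y).PosDef) : Continuous fun y => sph (A y) (z y) := by
  have h : Continuous (Function.uncurry fun (y : Y) (k : unitaryGroup (Fin n) ℂ) =>
      minorPow n ((k : Matrix (Fin n) (Fin n) ℂ)ᴴ * A y * k) (z y)) :=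
    continuous_minorPow n _ _ (by fun_prop) (by fun_prop)
      fun p => posDef_conj_of_isUnit (hp p.1) (isUnit_unitary p.2)
  simpa [sph] using continuous_parametric_integral_of_continuous (μ := haarU n) h isCompact_univ

theorem sph_one {n : ℕ} (z : Fin n → ℂ) : sph 1 z = 1 := by
  simp [sph, conjTranspose_mul_unitary, minorPow_one]

theorem sph_conj_unitary {n : ℕ} (C : Matrix (Fin n) (Fin n) ℂ) (z : Fin n → ℂ)
    (V : unitaryGroup (Fin n) ℂ) :
    sph ((V : Matrix (Fin n) (Fin n) ℂ)ᴴ * C * V.1) z = sph C z := by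
  rw [sph, sph, ← integral_mul_left_eq_self
    (fun k : unitaryGroup (Fin n) ℂ => minorPow n ((k : Matrix (Fin n) (Fin n) ℂ)ᴴ * C * k) z) V]
  congr 1; ext k
  simp [conjTranspose_mul, Matrix.mul_assoc]

theorem integral_norm_minorPow {n : ℕ} (C : Matrix (Fin n) (Fin n) ℂ) (z : Fin n → ℂ) :
    ((∫ k : unitaryGroup (Fin n) ℂ, ‖minorPow n ((k : Matrix (Fin n) (Fin n) ℂ)ᴴ * C * k) z‖
      ∂haarU n : ℝ) : ℂ) = sph C fun i => ((z i).re : ℂ) := by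
  rw [← integral_complex_ofReal, sph]
  congr 1; ext k
  exact norm_minorPow _ _ _

theorem norm_sph_le {n : ℕ} (C : Matrix (Fin n) (Fin n) ℂ) (z : Fin n → ℂ) :
    ‖sph C z‖ ≤ ‖sph C fun i => ((z i).re : ℂ)‖ := by
  rw [← integral_norm_minorPow, Complex.norm_real]
  exact (norm_integral_le_integral_norm _).trans (le_abs_self _)

/-- With a real parameter the integrand is positive, so identities between spherical functions are
also identities between their norms. -/
theorem sph_ofReal {n : ℕ} (C : Matrix (Fin n) (Fin n) ℂ) (r : Fin n → ℝ) :
    sph C (fun i => (r i : ℂ)) = (‖sph C (fun i => (r i : ℂ))‖ : ℝ) := by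
  have h := integral_norm_minorPow C (fun i => (r i : ℂ))
  simp only [Complex.ofReal_re] at h
  rw [← h, Complex.norm_real, Real.norm_of_nonneg (integral_nonneg fun _ => norm_nonneg _)]

theorem norm_sph_le_sum {n : ℕ} {C : Matrix (Fin n) (Fin n) ℂ} (hC : C.PosDef) (l u : Fin n → ℝ)
    (z : Fin n → ℂ) (hl : ∀ i, l i ≤ (z i).re) (hu : ∀ i, (z i).re ≤ u i) :
    ‖sph C z‖ ≤ ∑ v : Fin n → Bool, ‖sph C (fun i => ((if v i then l i else u i : ℝ) : ℂ))‖ := by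
  have h : ∀ r : Fin n → ℝ, ‖sph C (fun i => (r i : ℂ))‖ = ∫ k : unitaryGroup (Fin n) ℂ,
      ‖minorPow n ((k : Matrix (Fin n) (Fin n) ℂ)ᴴ * C * k) (fun i => (r i : ℂ))‖ ∂haarU n := by
    intro r
    have h := integral_norm_minorPow C (fun i => (r i : ℂ))
    simp only [Complex.ofReal_re] at h
    rw [← h, Complex.norm_real, Real.norm_of_nonneg (integral_nonneg fun _ => norm_nonneg _)]
  simp only [h]
  rw [← integral_finsetSum _ fun v _ => (integrable_minorPow_conj hC _).norm]
  refine (norm_integral_le_integral_norm _).trans (integral_mono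
    (integrable_minorPow_conj hC _).norm
    (integrable_finsetSum _ fun v _ => (integrable_minorPow_conj hC _).norm) fun k => ?_)
  exact norm_minorPow_le_sum n _ l u z hl hu

/-- Iwasawa decomposition: with `B` lower triangular and `Bᴴ * (hᴴ * h) * B = 1`, the matrix `U = h
* B` is unitary, and the triangular part of `h` splits off as a scalar. What matters is that `U`
does not depend on `k`. -/
theorem minorPow_gram_mul {n : ℕ} {g h : Matrix (Fin n) (Fin n) ℂ} (hg : IsUnit g)
    (hh : IsUnit h) (z : Fin n → ℂ) : ∃ U : unitaryGroup (Fin n) ℂ,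
    ∀ k : unitaryGroup (Fin n) ℂ, minorPow n ((g * k.1 * h)ᴴ * (g * k.1 * h)) z =
      minorPow n (((k * U : unitaryGroup (Fin n) ℂ) : Matrix (Fin n) (Fin n) ℂ)ᴴ * (gᴴ * g) *
        (k * U : unitaryGroup (Fin n) ℂ)) z * minorPow n (hᴴ * h) z := by
  obtain ⟨B, hB, hl, h1⟩ := exists_lowerTriangular_conj_eq_one (posDef_gram hh)
  have hU : h * B ∈ unitaryGroup (Fin n) ℂ := by
    rw [mem_unitaryGroup_iff', star_eq_conjTranspose, conjTranspose_mul, ← h1]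
    simp only [Matrix.mul_assoc]
  refine ⟨⟨h * B, hU⟩, fun k => ?_⟩
  have e1 := minorPow_conj n _ B z (posDef_gram ((hg.mul (isUnit_unitary k)).mul hh)) hB hl
  have e2 := minorPow_conj n _ B z (posDef_gram hh) hB hl
  rw [h1, minorPow_one] at e2
  have e3 : (((k * ⟨h * B, hU⟩ : unitaryGroup (Fin n) ℂ) : Matrix (Fin n) (Fin n) ℂ)ᴴ * (gᴴ * g) *
        (k * ⟨h * B, hU⟩ : unitaryGroup (Fin n) ℂ)) =
      Bᴴ * ((g * k.1 * h)ᴴ * (g * k.1 * h)) * B := by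
    simp [conjTranspose_mul, Matrix.mul_assoc]
  rw [e3, e1]
  linear_combination minorPow n ((g * k.1 * h)ᴴ * (g * k.1 * h)) z * e2

/-- The functional equation of spherical functions. -/
theorem integral_sph_mul {n : ℕ} {g h : Matrix (Fin n) (Fin n) ℂ} (hg : IsUnit g)
    (hh : IsUnit h) (z : Fin n → ℂ) :
    ∫ k : unitaryGroup (Fin n) ℂ, sph ((g * k.1 * h)ᴴ * (g * k.1 * h)) z ∂haarU n =
      sph (gᴴ * g) z * sph (hᴴ * h) z := by
  -- For fixed `k'` the unitary part of `h * k'` is absorbed by right invariance of Haar measure;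
  -- Fubini then allows `k'` to be averaged last.
  have key : ∀ k' : unitaryGroup (Fin n) ℂ, ∫ k : unitaryGroup (Fin n) ℂ,
      minorPow n ((k' : Matrix (Fin n) (Fin n) ℂ)ᴴ * ((g * k.1 * h)ᴴ * (g * k.1 * h)) * k'.1) z ∂haarU n =
      sph (gᴴ * g) z * minorPow n ((k' : Matrix (Fin n) (Fin n) ℂ)ᴴ * (hᴴ * h) * k'.1) z := by
    intro k'
    obtain ⟨U, hU⟩ := minorPow_gram_mul hg (hh.mul (isUnit_unitary k')) z
    have e : ∀ k : unitaryGroup (Fin n) ℂ,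
        (k' : Matrix (Fin n) (Fin n) ℂ)ᴴ * ((g * k.1 * h)ᴴ * (g * k.1 * h)) * k'.1 =
        (g * k.1 * (h * k'.1))ᴴ * (g * k.1 * (h * k'.1)) := fun k => by
      simp [conjTranspose_mul, Matrix.mul_assoc]
    have e' : (k' : Matrix (Fin n) (Fin n) ℂ)ᴴ * (hᴴ * h) * k'.1 = (h * k'.1)ᴴ * (h * k'.1) := by
      simp [conjTranspose_mul, Matrix.mul_assoc]
    simp only [e, hU, e']
    rw [integral_mul_const, integral_mul_right_eq_self
      (fun k : unitaryGroup (Fin n) ℂ =>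
        minorPow n ((k : Matrix (Fin n) (Fin n) ℂ)ᴴ * (gᴴ * g) * k.1) z) U, sph]
  calc ∫ k : unitaryGroup (Fin n) ℂ, sph ((g * k.1 * h)ᴴ * (g * k.1 * h)) z ∂haarU n
      = ∫ k' : unitaryGroup (Fin n) ℂ, ∫ k : unitaryGroup (Fin n) ℂ,
      minorPow n ((k' : Matrix (Fin n) (Fin n) ℂ)ᴴ * ((g * k.1 * h)ᴴ * (g * k.1 * h)) * k'.1) z
        ∂haarU n ∂haarU n := by
        unfold sph
        refine integral_integral_swap ?_
        have hc : Continuous (Function.uncurry fun k k' : unitaryGroup (Fin n) ℂ =>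
            minorPow n ((k' : Matrix (Fin n) (Fin n) ℂ)ᴴ * ((g * k.1 * h)ᴴ * (g * k.1 * h)) * k'.1) z) :=
          continuous_minorPow n _ _ (by fun_prop) continuous_const fun p =>
            posDef_conj_of_isUnit (posDef_gram ((hg.mul (isUnit_unitary p.1)).mul hh))
              (isUnit_unitary p.2)
        rw [← integrableOn_univ]
        exact hc.continuousOn.integrableOn_compact isCompact_univ
    _ = _ := by
        simp only [key]
        rw [integral_const_mul, sph, sph]

end RMP

end

noncomputable section

namespace RMP
open Matrix

/-! ### Interlacing coordinates -/

/-- The box of points strictly interlacing with `x`. -/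
def interlacingBox {n : ℕ} (x : Fin (n + 1) → ℝ) : Set (Fin n → ℝ) :=
  Set.univ.pi fun j => Set.Ioo (x j.castSucc) (x j.succ)

/-- `∏_{l ≠ i} (x_i - x_l)`. -/
def nodeProd {n : ℕ} (x : Fin (n + 1) → ℝ) (i : Fin (n + 1)) : ℝ :=
  ∏ j : Fin n, (x i - x (i.succAbove j))

/-- The coordinates `(r, b)` with `r > 0` and `b` interlacing with `x`. -/
def interlacingDomain {n : ℕ} (x : Fin (n + 1) → ℝ) : Set (Fin (n + 1) → ℝ) :=
  {q | 0 < q 0 ∧ Fin.tail q ∈ interlacingBox x}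

/-- The weights `p` for which `∑ p_i ∏_{l ≠ i} (t - x_l) = r ∏ (t - b_j)`. -/
def interlacingMap {n : ℕ} (x : Fin (n + 1) → ℝ) (q : Fin (n + 1) → ℝ) : Fin (n + 1) → ℝ :=
  fun i => q 0 * (∏ j : Fin n, (x i - q j.succ)) * (nodeProd x i)⁻¹

section
variable {n : ℕ} {x : Fin (n + 1) → ℝ}

theorem mem_interlacingBox {b : Fin n → ℝ} :
    b ∈ interlacingBox x ↔ ∀ j, x j.castSucc < b j ∧ b j < x j.succ := by
  simp [interlacingBox]

theorem measurableSet_interlacingBox : MeasurableSet (interlacingBox x) :=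
  MeasurableSet.univ_pi fun _ => measurableSet_Ioo

theorem measurableSet_interlacingDomain : MeasurableSet (interlacingDomain x) := by
  refine (measurableSet_lt measurable_const (measurable_pi_apply 0)).inter ?_
  have : Measurable (fun q : Fin (n + 1) → ℝ => Fin.tail q) :=
    measurable_pi_lambda _ fun j => measurable_pi_apply j.succ
  exact this measurableSet_interlacingBox

theorem strictMono_of_mem_interlacingBox (hx : StrictMono x) {b : Fin n → ℝ}
    (hb : b ∈ interlacingBox x) : StrictMono b := by
  intro i j hij
  rw [mem_interlacingBox] at hb
  have : x i.succ ≤ x j.castSucc := hx.monotone (by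
    rw [Fin.le_def]; simpa using hij)
  exact (hb i).2.trans_le (this.trans (hb j).1.le)

theorem nodeProd_ne_zero (hx : StrictMono x) (i : Fin (n + 1)) : nodeProd x i ≠ 0 :=
  Finset.prod_ne_zero_iff.2 fun j _ => sub_ne_zero.2 (hx.injective.ne (Fin.succAbove_ne i j).symm)

/-- By interlacing, `b_j` and `x (i.succAbove j)` lie on the same side of `x i`, so every quotient
of paired factors is positive. -/
theorem interlacingMap_pos (hx : StrictMono x) {q : Fin (n + 1) → ℝ}
    (hq : q ∈ interlacingDomain x) (i : Fin (n + 1)) : 0 < interlacingMap x q i := by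
  have hb := mem_interlacingBox.1 hq.2
  rw [interlacingMap, nodeProd, mul_assoc, ← Finset.prod_inv_distrib, ← Finset.prod_mul_distrib]
  refine mul_pos hq.1 (Finset.prod_pos fun j _ => ?_)
  have hbj := hb j
  simp only [Fin.tail] at hbj
  rw [← div_eq_mul_inv]
  rcases lt_or_ge j.castSucc i with h | h
  · rw [Fin.succAbove_of_castSucc_lt _ _ h]
    have h1 : x j.succ ≤ x i := hx.monotone (by
      rw [Fin.le_def]; rw [Fin.lt_def] at h; simpa using h)
    exact div_pos (by linarith) (by linarith)
  · rw [Fin.succAbove_of_le_castSucc _ _ h]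
    have h1 : x i ≤ x j.castSucc := hx.monotone h
    exact div_pos_of_neg_of_neg (by linarith) (by linarith)

open Polynomial in
/-- `∑ p_i ∏_{l ≠ i} (t - x_l)`. -/
def nodePoly (x p : Fin (n + 1) → ℝ) : ℝ[X] :=
  ∑ i, C (p i) * ∏ j : Fin n, (X - C (x (i.succAbove j)))

open Polynomial in
theorem eval_nodePoly (p : Fin (n + 1) → ℝ) (t : ℝ) :
    (nodePoly x p).eval t = ∑ i, p i * ∏ j : Fin n, (t - x (i.succAbove j)) := by
  simp [nodePoly, eval_finsetSum, eval_prod]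

theorem eval_nodePoly_node (p : Fin (n + 1) → ℝ) (i : Fin (n + 1)) :
    (nodePoly x p).eval (x i) = p i * nodeProd x i := by
  rw [eval_nodePoly, Finset.sum_eq_single i]
  · rfl
  · intro l _ hl
    obtain ⟨j, hj⟩ := Fin.exists_succAbove_eq hl.symm
    rw [Finset.prod_eq_zero (Finset.mem_univ j), mul_zero]
    rw [hj, sub_self]
  · simp

open Polynomial in
theorem natDegree_prod_linear {ι : Type*} (s : Finset ι) (b : ι → ℝ) :
    (∏ j ∈ s, (X - C (b j))).natDegree = s.card := by
  simp

open Polynomial in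
theorem coeff_prod_linear (b : Fin n → ℝ) : (∏ j, (X - C (b j))).coeff n = 1 := by
  have h := monic_prod_X_sub_C b Finset.univ
  have h2 := natDegree_prod_linear Finset.univ b
  rw [Finset.card_fin] at h2
  rw [Monic, leadingCoeff, h2] at h
  exact h

open Polynomial in
theorem natDegree_nodePoly (p : Fin (n + 1) → ℝ) : (nodePoly x p).natDegree ≤ n := by
  refine natDegree_sum_le_of_forall_le _ _ fun i _ => (natDegree_C_mul_le _ _).trans ?_
  rw [natDegree_prod_linear, Finset.card_fin]

open Polynomial in
theorem coeff_nodePoly (p : Fin (n + 1) → ℝ) : (nodePoly x p).coeff n = ∑ i, p i := by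
  simp [nodePoly, finsetSum_coeff, coeff_prod_linear]

open Polynomial in
-- Lagrange interpolation: both sides have degree at most `n` and agree at the `n + 1` nodes.
theorem nodePoly_interlacingMap (hx : StrictMono x) (q : Fin (n + 1) → ℝ) :
    nodePoly x (interlacingMap x q) = C (q 0) * ∏ j : Fin n, (X - C (q j.succ)) := by
  refine eq_of_natDegree_lt_card_of_eval_eq _ _ hx.injective (fun i => ?_) ?_
  · rw [eval_nodePoly_node, interlacingMap, inv_mul_cancel_right₀ (nodeProd_ne_zero hx i)]
    simp [eval_prod]
  · rw [Fintype.card_fin, Nat.lt_succ_iff]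
    refine max_le (natDegree_nodePoly _) ((natDegree_C_mul_le _ _).trans ?_)
    rw [natDegree_prod_linear, Finset.card_fin]

theorem sum_interlacingMap (hx : StrictMono x) (q : Fin (n + 1) → ℝ) :
    ∑ i, interlacingMap x q i = q 0 := by
  rw [← coeff_nodePoly (x := x), nodePoly_interlacingMap hx, Polynomial.coeff_C_mul,
    coeff_prod_linear, mul_one]

/-- The polynomial determines `r` as its coefficient of degree `n` and the `b_j` as its roots; since
each gap between nodes holds exactly one root, the labelling is determined too. -/
theorem injOn_interlacingMap (hx : StrictMono x) :
    Set.InjOn (interlacingMap x) (interlacingDomain x) := by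
  intro q hq q' hq' h
  have h0 : q 0 = q' 0 := by rw [← sum_interlacingMap hx q, h, sum_interlacingMap hx]
  have hp := nodePoly_interlacingMap hx q
  rw [h, nodePoly_interlacingMap hx q'] at hp
  have hb := mem_interlacingBox.1 hq.2
  have hb' := mem_interlacingBox.1 hq'.2
  simp only [Fin.tail] at hb hb'
  funext i
  refine Fin.cases h0 (fun j => ?_) i
  have he := congrArg (Polynomial.eval (q j.succ)) hp
  have hz : ∏ l : Fin n, (q j.succ - q l.succ) = 0 :=
    Finset.prod_eq_zero (Finset.mem_univ j) (sub_self _)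
  simp only [Polynomial.eval_mul, Polynomial.eval_C, Polynomial.eval_prod, Polynomial.eval_sub,
    Polynomial.eval_X, hz, mul_zero, mul_eq_zero, hq'.1.ne', false_or] at he
  obtain ⟨l, -, hl⟩ := Finset.prod_eq_zero_iff.1 he
  rw [sub_eq_zero] at hl
  rcases lt_trichotomy j l with hjl | rfl | hjl
  · have : x j.succ ≤ x l.castSucc := hx.monotone (by rw [Fin.le_def]; simpa using hjl)
    linarith [(hb j).2, (hb' l).1]
  · exact hl
  · have : x l.succ ≤ x j.castSucc := hx.monotone (by rw [Fin.le_def]; simpa using hjl)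
    linarith [(hb j).1, (hb' l).2]

/-- Only the factors joining the two adjacent nodes have opposite signs; every other node lies on
the same side of both. -/
theorem nodeProd_mul_neg (hx : StrictMono x) (j : Fin n) :
    nodeProd x j.castSucc * nodeProd x j.succ < 0 := by
  rw [nodeProd, nodeProd, ← Finset.prod_mul_distrib, ← Finset.mul_prod_erase _ _ (Finset.mem_univ j)]
  refine mul_neg_of_neg_of_pos ?_ (Finset.prod_pos fun l hl => ?_)
  · rw [Fin.succAbove_of_le_castSucc _ _ le_rfl, Fin.succAbove_of_castSucc_lt _ _ (by
      simp [Fin.lt_def])]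
    have := hx (show j.castSucc < j.succ by simp [Fin.lt_def])
    exact mul_neg_of_neg_of_pos (by linarith) (by linarith)
  · have hne := Finset.ne_of_mem_erase hl
    rcases lt_or_gt_of_ne hne with h | h
    · rw [Fin.succAbove_of_castSucc_lt _ _ (Fin.castSucc_lt_castSucc_iff.2 h),
        Fin.succAbove_of_castSucc_lt _ _ (by rw [Fin.lt_def] at h ⊢; simp; omega)]
      have h1 := hx (Fin.castSucc_lt_castSucc_iff.2 h)
      have h2 := hx (show j.castSucc < j.succ by simp [Fin.lt_def])
      exact mul_pos (by linarith) (by linarith)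
    · rw [Fin.succAbove_of_le_castSucc _ _ (by rw [Fin.lt_def] at h; rw [Fin.le_def]; simp; omega),
        Fin.succAbove_of_le_castSucc _ _ (by rw [Fin.lt_def] at h; rw [Fin.le_def]; simp; omega)]
      have h1 := hx (Fin.succ_lt_succ_iff.2 h)
      have h2 := hx (show j.castSucc < j.succ by simp [Fin.lt_def])
      exact mul_pos_of_neg_of_neg (by linarith) (by linarith)

/-- For positive weights the node polynomial changes sign between adjacent nodes, so every gap
contains a root. These `n` roots together with the coefficient `∑ p_i` of degree `n` determine it.
-/
theorem exists_interlacingMap_eq (hx : StrictMono x) {p : Fin (n + 1) → ℝ} (hp : ∀ i, 0 < p i) :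
    ∃ q ∈ interlacingDomain x, interlacingMap x q = p := by
  have hroot : ∀ j : Fin n, ∃ b ∈ Set.Ioo (x j.castSucc) (x j.succ),
      (nodePoly x p).eval b = 0 := by
    intro j
    have hlt := hx (show j.castSucc < j.succ by simp [Fin.lt_def])
    have hc : ContinuousOn (fun t => (nodePoly x p).eval t) (Set.Icc (x j.castSucc) (x j.succ)) :=
      (nodePoly x p).continuous.continuousOn
    have hn := nodeProd_mul_neg hx j
    rcases mul_neg_iff.1 hn with ⟨h1, h2⟩ | ⟨h1, h2⟩
    · obtain ⟨b, hb, h0⟩ := intermediate_value_Ioo' hlt.le hc (show (0 : ℝ) ∈ _ from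
        ⟨by simpa only [eval_nodePoly_node] using mul_neg_of_pos_of_neg (hp _) h2,
          by simpa only [eval_nodePoly_node] using mul_pos (hp _) h1⟩)
      exact ⟨b, hb, h0⟩
    · obtain ⟨b, hb, h0⟩ := intermediate_value_Ioo hlt.le hc (show (0 : ℝ) ∈ _ from
        ⟨by simpa only [eval_nodePoly_node] using mul_neg_of_pos_of_neg (hp _) h1,
          by simpa only [eval_nodePoly_node] using mul_pos (hp _) h2⟩)
      exact ⟨b, hb, h0⟩
  choose b hb hb0 using hroot
  have hbox : b ∈ interlacingBox x := mem_interlacingBox.2 fun j => hb j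
  refine ⟨Fin.cons (∑ i, p i) b, ⟨?_, ?_⟩, ?_⟩
  · simpa using Finset.sum_pos (fun i _ => hp i) Finset.univ_nonempty
  · simpa using hbox
  · have hpoly : nodePoly x p = Polynomial.C (∑ i, p i) *
        ∏ j : Fin n, (Polynomial.X - Polynomial.C (b j)) := by
      refine Polynomial.eq_of_degree_sub_lt_of_eval_index_eq (v := b) Finset.univ
        (strictMono_of_mem_interlacingBox hx hbox).injective.injOn ?_ ?_
      · rw [Finset.card_fin]
        -- The coefficients of degree `n` agree, so the difference has degree below `n` while it
        -- vanishes at the `n` points `b_j`.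
        refine (Polynomial.degree_lt_iff_coeff_zero _ _).2 fun m hm => ?_
        rcases eq_or_lt_of_le hm with rfl | hm
        · rw [Polynomial.coeff_sub, coeff_nodePoly, Polynomial.coeff_C_mul, coeff_prod_linear,
            mul_one, sub_self]
        · refine Polynomial.coeff_eq_zero_of_natDegree_lt (lt_of_le_of_lt
            (Polynomial.natDegree_sub_le _ _) (lt_of_le_of_lt (max_le (natDegree_nodePoly _)
            ((Polynomial.natDegree_C_mul_le _ _).trans ?_)) hm))
          rw [natDegree_prod_linear, Finset.card_fin]
      · intro j _
        rw [hb0]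
        simp [Polynomial.eval_prod, Finset.prod_eq_zero (Finset.mem_univ j)]
    funext i
    have h := congrArg (Polynomial.eval (x i)) hpoly
    rw [eval_nodePoly_node] at h
    simp only [interlacingMap, Fin.cons_zero, Fin.cons_succ]
    rw [mul_inv_eq_iff_eq_mul₀ (nodeProd_ne_zero hx i), h]
    simp only [Polynomial.eval_mul, Polynomial.eval_C, Polynomial.eval_prod, Polynomial.eval_sub,
      Polynomial.eval_X]

theorem image_interlacingMap (hx : StrictMono x) :
    interlacingMap x '' (interlacingDomain x ∩ {q | q 0 < 1}) =
      {p | (∀ i, 0 < p i) ∧ ∑ i, p i < 1} := by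
  ext p
  constructor
  · rintro ⟨q, ⟨hq, h1⟩, rfl⟩
    exact ⟨interlacingMap_pos hx hq, by rw [sum_interlacingMap hx]; exact h1⟩
  · rintro ⟨hp, h1⟩
    obtain ⟨q, hq, rfl⟩ := exists_interlacingMap_eq hx hp
    exact ⟨q, ⟨hq, by rw [sum_interlacingMap hx] at h1; exact h1⟩, rfl⟩

end

end RMP

end

noncomputable section

namespace RMP
open Matrix

/-! ### The Jacobian of the interlacing coordinates -/

/-- Column polynomials `∏ (t - b_j)` and `∏_{l ≠ j} (t - b_l)`. -/
def jacPoly {n : ℕ} (b : Fin n → ℝ) : Fin (n + 1) → Polynomial ℝ :=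
  Fin.cons (∏ l, (Polynomial.X - Polynomial.C (b l)))
    fun j => ∏ l ∈ Finset.univ.erase j, (Polynomial.X - Polynomial.C (b l))

section
variable {n : ℕ}

theorem natDegree_jacPoly (b : Fin n → ℝ) (k : Fin (n + 1)) :
    (jacPoly b k).natDegree < n + 1 := by
  refine Fin.cases ?_ (fun j => ?_) k
  · rw [jacPoly, Fin.cons_zero, natDegree_prod_linear, Finset.card_fin]; omega
  · rw [jacPoly, Fin.cons_succ, natDegree_prod_linear]
    have := Finset.card_le_univ (Finset.univ.erase j)
    rw [Fintype.card_fin] at this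
    omega

theorem evalMatrix_jacPoly (b : Fin n → ℝ) (y : Fin (n + 1) → ℝ) :
    (Matrix.of fun i k => (jacPoly b k).eval (y i)) =
      Matrix.vandermonde y * Matrix.of fun i k : Fin (n + 1) => (jacPoly b k).coeff i := by
  ext i k
  rw [Matrix.of_apply, Polynomial.eval_eq_sum_range' (natDegree_jacPoly b k), mul_apply,
    ← Fin.sum_univ_eq_sum_range (fun m => (jacPoly b k).coeff m * y i ^ m)]
  simp [Matrix.vandermonde, mul_comm]

theorem abs_det_vandermonde_sq (b : Fin n → ℝ) :
    |(Matrix.vandermonde b).det| * |(Matrix.vandermonde b).det| =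
      ∏ j, ∏ l ∈ Finset.univ.erase j, |b j - b l| := by
  have h := Finset.prod_prod_Ioi_mul_eq_prod_prod_off_diag fun i j : Fin n => |b j - b i|
  simp only [Finset.prod_mul_distrib] at h
  rw [det_vandermonde]
  simp only [Finset.abs_prod]
  calc _ = (∏ i, ∏ j ∈ Finset.Ioi i, |b i - b j|) * ∏ i, ∏ j ∈ Finset.Ioi i, |b j - b i| := by
        congr 1
        exact Finset.prod_congr rfl fun i _ => Finset.prod_congr rfl fun j _ => abs_sub_comm _ _
    _ = _ := h
    _ = _ := by
        refine Finset.prod_congr rfl fun i _ => Finset.prod_congr ?_ fun j _ => rfl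
        ext j; simp

/-- Evaluated at `(y0, b)`, the column polynomials form a block triangular matrix with determinant
`± ∏ (y0 - b_j)` times the squared Vandermonde determinant of `b`. Dividing by the Vandermonde
determinant of `(y0, b)` leaves that of `b`, up to sign. -/
theorem abs_det_coeff_jacPoly {b : Fin n → ℝ} (hb : Function.Injective b) :
    |(Matrix.of fun i k : Fin (n + 1) => (jacPoly b k).coeff i).det| =
      |(Matrix.vandermonde b).det| := by
  -- An auxiliary node different from all `b_j`, so that the factors `b_j - y0` can be cancelled.
  obtain ⟨y0, hy0⟩ := (Set.finite_range b).exists_notMem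
  have hne : ∀ j, b j - y0 ≠ 0 := fun j => sub_ne_zero.2 fun h => hy0 ⟨j, h⟩
  have hdet := congrArg Matrix.det (evalMatrix_jacPoly b (Fin.cons y0 b))
  rw [det_mul, det_succ_column_zero, Fin.sum_univ_succ, Finset.sum_eq_zero, add_zero] at hdet
  swap
  · intro i _
    have : (jacPoly b 0).eval (b i) = 0 := by
      rw [jacPoly, Fin.cons_zero, Polynomial.eval_prod]
      exact Finset.prod_eq_zero (Finset.mem_univ i) (by simp)
    simp [this]
  have hsub : (Matrix.of fun i k => (jacPoly b k).eval ((Fin.cons y0 b : Fin (n + 1) → ℝ) i)).submatrix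
      (Fin.succAbove 0) Fin.succ = diagonal fun j => ∏ l ∈ Finset.univ.erase j, (b j - b l) := by
    ext i j
    simp only [submatrix_apply, Fin.succAbove_zero, of_apply, Fin.cons_succ, jacPoly,
      Polynomial.eval_prod, Polynomial.eval_sub, Polynomial.eval_X, Polynomial.eval_C]
    rcases eq_or_ne i j with rfl | h
    · simp
    · rw [diagonal_apply_ne _ h, Finset.prod_eq_zero (Finset.mem_erase.2 ⟨h, Finset.mem_univ i⟩)]
      simp
  have hv : (Matrix.vandermonde (Fin.cons y0 b : Fin (n + 1) → ℝ)).det =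
      (∏ j, (b j - y0)) * (Matrix.vandermonde b).det := by
    rw [det_vandermonde, det_vandermonde, Fin.prod_univ_succ]
    simp [Fin.prod_Ioi_succ]
  rw [hsub, hv, det_diagonal] at hdet
  have habs := congrArg abs hdet
  simp only [of_apply, Fin.cons_zero, jacPoly, Polynomial.eval_prod, Polynomial.eval_sub,
    Polynomial.eval_X, Polynomial.eval_C, abs_mul, Finset.abs_prod, Fin.val_zero, pow_zero,
    one_mul] at habs
  rw [← abs_det_vandermonde_sq] at habs
  have hp : (∏ j, |y0 - b j|) = ∏ j, |b j - y0| :=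
    Finset.prod_congr rfl fun j _ => abs_sub_comm _ _
  rw [hp, mul_assoc] at habs
  have h1 : (∏ j, |b j - y0|) ≠ 0 := Finset.prod_ne_zero_iff.2 fun j _ => abs_ne_zero.2 (hne j)
  have h2 : |(Matrix.vandermonde b).det| ≠ 0 := abs_ne_zero.2 (det_vandermonde_ne_zero_iff.2 hb)
  exact (mul_left_cancel₀ h2 (mul_left_cancel₀ h1 habs)).symm

/-- The Jacobian matrix of `interlacingMap`. -/
def interlacingJac (x q : Fin (n + 1) → ℝ) : Matrix (Fin (n + 1)) (Fin (n + 1)) ℝ :=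
  Matrix.of fun i k => (nodeProd x i)⁻¹ * ((jacPoly (Fin.tail q) k).eval (x i) *
    (Fin.cons 1 (fun _ => -q 0) : Fin (n + 1) → ℝ) k)

theorem hasFDerivAt_interlacingMap (x q : Fin (n + 1) → ℝ) :
    HasFDerivAt (interlacingMap x)
      (LinearMap.toContinuousLinearMap (Matrix.toLin' (interlacingJac x q))) q := by
  rw [hasFDerivAt_pi']
  intro i
  have hprod : HasFDerivAt (fun q : Fin (n + 1) → ℝ => ∏ j : Fin n, (x i - q j.succ))
      (∑ j : Fin n, (∏ l ∈ Finset.univ.erase j, (x i - q l.succ)) •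
        (-ContinuousLinearMap.proj (R := ℝ) (φ := fun _ : Fin (n + 1) => ℝ) j.succ)) q := by
    refine HasFDerivAt.finsetProd fun j _ => ?_
    exact (hasFDerivAt_apply j.succ q).const_sub (x i)
  have h := ((hasFDerivAt_apply (𝕜 := ℝ) (0 : Fin (n + 1)) q).mul hprod).mul_const
    (nodeProd x i)⁻¹
  refine h.congr_fderiv ?_
  ext v
  simp [interlacingJac, mulVec, dotProduct, Fin.sum_univ_succ, jacPoly, Polynomial.eval_prod,
    Fin.tail]
  rw [add_comm, Finset.mul_sum, Finset.mul_sum]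
  congr 1
  · ring
  · exact congrArg _ (Finset.sum_congr rfl fun j _ => by ring)

/-- The Jacobian matrix is a product of diagonal matrices, the Vandermonde matrix of `x` and the
coefficient matrix. Hence `r` and `b` separate, and `b` enters only through its Vandermonde
determinant. -/
theorem abs_det_interlacingJac {x q : Fin (n + 1) → ℝ} (hq : Function.Injective (Fin.tail q)) :
    |(interlacingJac x q).det| = |∏ i, (nodeProd x i)⁻¹| * |(Matrix.vandermonde x).det| *
      (|q 0| ^ n * |(Matrix.vandermonde (Fin.tail q)).det|) := by
  have h : interlacingJac x q = diagonal (fun i => (nodeProd x i)⁻¹) *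
      (Matrix.of fun i k => (jacPoly (Fin.tail q) k).eval (x i)) *
        diagonal (Fin.cons 1 (fun _ => -q 0) : Fin (n + 1) → ℝ) := by
    ext i k
    simp [interlacingJac, mul_diagonal, diagonal_mul, mul_assoc]
  rw [h, det_mul, det_mul, det_diagonal, det_diagonal, evalMatrix_jacPoly, det_mul, abs_mul,
    abs_mul, abs_mul, abs_det_coeff_jacPoly hq, Fin.prod_univ_succ]
  simp [abs_mul, abs_pow]
  ring

end

end RMP

end

noncomputable section

namespace RMP
open Matrix
open scoped ENNReal

/-! ### Squared moduli of the coordinates of a random vector -/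

/-- The squared moduli of the coordinates. -/
def sqAbs {N : ℕ} (v : Fin N → ℂ) : Fin N → ℝ := fun i => ‖v i‖ ^ 2

/-- The Euclidean unit ball. -/
def unitBall (N : ℕ) : Set (Fin N → ℂ) := {v | ∑ i, sqAbs v i < 1}

theorem map_sq_norm_volume :
    Measure.map (fun z : ℂ => ‖z‖ ^ 2) volume =
      ENNReal.ofReal Real.pi • (volume : Measure ℝ).restrict (Set.Ioi 0) := by
  have hm : Measurable fun z : ℂ => ‖z‖ ^ 2 := by fun_prop
  -- The annulus `a ≤ |z|² < b` has area `π (b - a)`; truncation at 0 handles negative endpoints.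
  have key : ∀ a b : ℝ, a < b → Measure.map (fun z : ℂ => ‖z‖ ^ 2) volume (Set.Ico a b) =
      ENNReal.ofReal (Real.pi * (max b 0 - max a 0)) := by
    intro a b hab
    have hball : ∀ c : ℝ, {z : ℂ | ‖z‖ ^ 2 < c} = Metric.ball 0 (Real.sqrt (max c 0)) := by
      intro c
      ext z
      simp only [Set.mem_ofPred_eq, mem_ball_zero_iff]
      rw [Real.lt_sqrt (norm_nonneg z), lt_max_iff]
      exact ⟨Or.inl, fun h => h.resolve_right (not_lt.2 (sq_nonneg _))⟩
    have hset : (fun z : ℂ => ‖z‖ ^ 2) ⁻¹' Set.Ico a b =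
        {z : ℂ | ‖z‖ ^ 2 < b} \ {z : ℂ | ‖z‖ ^ 2 < a} := by
      ext z; simp [and_comm]
    have hmono : max a 0 ≤ max b 0 := max_le_max_right _ hab.le
    rw [Measure.map_apply hm measurableSet_Ico, hset, hball, hball,
      measure_sdiff (Metric.ball_subset_ball (Real.sqrt_le_sqrt hmono))
        measurableSet_ball.nullMeasurableSet measure_ball_lt_top.ne, Complex.volume_ball,
      Complex.volume_ball, ← ENNReal.ofReal_pow (Real.sqrt_nonneg _),
      ← ENNReal.ofReal_pow (Real.sqrt_nonneg _), Real.sq_sqrt (le_max_right _ _),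
      Real.sq_sqrt (le_max_right _ _)]
    have hpi : (NNReal.pi : ℝ≥0∞) = ENNReal.ofReal Real.pi := by
      rw [ENNReal.ofReal, ← NNReal.coe_real_pi, Real.toNNReal_coe]
    rw [hpi, ← ENNReal.ofReal_mul (le_max_right _ _), ← ENNReal.ofReal_mul (le_max_right _ _),
      ← ENNReal.ofReal_sub _ (mul_nonneg (le_max_right _ _) Real.pi_pos.le)]
    congr 1; ring
  refine Measure.ext_of_Ico' _ _ (fun a b hab => ?_) fun a b hab => ?_
  · rw [key a b hab]; exact ENNReal.ofReal_ne_top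
  · rw [key a b hab, Measure.smul_apply, Measure.restrict_apply measurableSet_Ico, smul_eq_mul,
      ENNReal.ofReal_mul Real.pi_pos.le]
    congr 1
    have he : (Set.Ico a b ∩ Set.Ici 0 : Set ℝ) = Set.Ico (max a 0) (max b 0) := by
      ext t
      simp only [Set.mem_inter_iff, Set.mem_Ico, Set.mem_Ici, max_le_iff, lt_max_iff]
      constructor
      · rintro ⟨⟨h1, h2⟩, h3⟩; exact ⟨⟨h1, h3⟩, Or.inl h2⟩
      · rintro ⟨⟨h1, h3⟩, h2⟩; exact ⟨⟨h1, h2.resolve_right (not_lt.2 h3)⟩, h3⟩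
    rw [measure_congr (ae_eq_set_inter (ae_eq_refl (Set.Ico a b)) Ioi_ae_eq_Ici), he,
      Real.volume_Ico]

theorem measurable_sqAbs {N : ℕ} : Measurable (sqAbs (N := N)) := by
  unfold sqAbs; fun_prop

theorem map_sqAbs_volume (N : ℕ) :
    Measure.map (sqAbs (N := N)) volume =
      ENNReal.ofReal Real.pi ^ N •
        (volume : Measure (Fin N → ℝ)).restrict {p | ∀ i, 0 < p i} := by
  have : SigmaFinite (Measure.map (fun z : ℂ => ‖z‖ ^ 2) volume) := by
    rw [map_sq_norm_volume]
    exact SMul.sigmaFinite (μ := (volume : Measure ℝ).restrict (Set.Ioi 0)) Real.pi.toNNReal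
  have h := Measure.pi_map_pi (ι := Fin N) (X := fun _ => ℂ) (Y := fun _ => ℝ)
    (μ := fun _ => volume) (f := fun _ z => ‖z‖ ^ 2) (hμ := fun _ => this)
    (fun _ => (by fun_prop : Measurable fun z : ℂ => ‖z‖ ^ 2).aemeasurable)
  have hs : {p : Fin N → ℝ | ∀ i, 0 < p i} = Set.univ.pi fun _ => Set.Ioi 0 := by
    ext p; simp
  rw [volume_pi, volume_pi, hs, Measure.restrict_pi_pi]
  refine Eq.trans h ?_
  refine Measure.pi_eq fun s hs => ?_
  rw [Measure.smul_apply, Measure.pi_pi]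
  simp [map_sq_norm_volume, Finset.prod_mul_distrib]

theorem measurableSet_unitBall {N : ℕ} : MeasurableSet (unitBall N) := by
  have : Measurable fun v : Fin N → ℂ => ∑ i, sqAbs v i :=
    Finset.measurable_sum _ fun i _ => (measurable_pi_apply i).comp measurable_sqAbs
  exact this measurableSet_Iio

theorem map_sqAbs_unitBall (N : ℕ) :
    Measure.map (sqAbs (N := N)) (volume.restrict (unitBall N)) =
      ENNReal.ofReal Real.pi ^ N •
        (volume : Measure (Fin N → ℝ)).restrict {p | (∀ i, 0 < p i) ∧ ∑ i, p i < 1} := by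
  have hm : MeasurableSet {p : Fin N → ℝ | ∑ i, p i < 1} :=
    measurableSet_lt (Finset.measurable_sum _ fun i _ => measurable_pi_apply i) measurable_const
  have h : unitBall N = sqAbs ⁻¹' {p : Fin N → ℝ | ∑ i, p i < 1} := rfl
  rw [h, ← Measure.restrict_map measurable_sqAbs hm, map_sqAbs_volume, Measure.restrict_smul,
    Measure.restrict_restrict hm]
  congr 2
  ext p; simp [and_comm]

theorem isOpen_unitBall {N : ℕ} : IsOpen (unitBall N) := by
  unfold unitBall sqAbs
  exact isOpen_lt (by fun_prop) continuous_const

theorem volume_unitBall_pos (N : ℕ) : 0 < volume (unitBall N) :=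
  isOpen_unitBall.measure_pos _ ⟨0, by simp [unitBall, sqAbs]⟩

theorem volume_unitBall_lt_top (N : ℕ) : volume (unitBall N) < ∞ := by
  refine lt_of_le_of_lt (measure_mono (t := Set.univ.pi fun _ => Metric.closedBall 0 1) ?_)
    (isCompact_univ_pi fun _ => isCompact_closedBall (0 : ℂ) 1).measure_lt_top
  intro v hv i _
  have h1 : sqAbs v i ≤ ∑ i, sqAbs v i :=
    Finset.single_le_sum (f := sqAbs v) (fun i _ => sq_nonneg _) (Finset.mem_univ i)
  have h2 : ‖v i‖ ^ 2 < 1 := h1.trans_lt hv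
  rw [mem_closedBall_zero_iff]
  exact ((sq_lt_one_iff₀ (norm_nonneg _)).1 h2).le

theorem sum_sqAbs_eq {N : ℕ} (v : Fin N → ℂ) : ((∑ i, sqAbs v i : ℝ) : ℂ) = star v ⬝ᵥ v := by
  simp [sqAbs, dotProduct, Complex.conj_mul']

theorem sum_sqAbs_mulVec {N : ℕ} (U : unitaryGroup (Fin N) ℂ) (v : Fin N → ℂ) :
    ∑ i, sqAbs (U.1 *ᵥ v) i = ∑ i, sqAbs v i := by
  have h : ((∑ i, sqAbs (U.1 *ᵥ v) i : ℝ) : ℂ) = (∑ i, sqAbs v i : ℝ) := by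
    rw [sum_sqAbs_eq, sum_sqAbs_eq, star_mulVec, ← dotProduct_mulVec, mulVec_mulVec,
      conjTranspose_mul_unitary, one_mulVec]
  exact_mod_cast h

/-- The image of Lebesgue measure is again an additive Haar measure, hence a multiple of it; the
invariant unit ball shows that the factor is 1. -/
theorem measurePreserving_mulVec {N : ℕ} (U : unitaryGroup (Fin N) ℂ) :
    MeasurePreserving (fun v : Fin N → ℂ => U.1 *ᵥ v) volume volume := by
  have hc : Continuous fun v : Fin N → ℂ => U.1 *ᵥ v := by fun_prop
  refine ⟨hc.measurable, ?_⟩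
  let e : (Fin N → ℂ) ≃+ (Fin N → ℂ) :=
    { toFun := fun v => U.1 *ᵥ v
      invFun := fun v => (U⁻¹).1 *ᵥ v
      left_inv := fun v => by
        beta_reduce
        rw [mulVec_mulVec, ← Submonoid.coe_mul, inv_mul_cancel]; simp
      right_inv := fun v => by
        beta_reduce
        rw [mulVec_mulVec, ← Submonoid.coe_mul, mul_inv_cancel]; simp
      map_add' := fun v w => mulVec_add _ _ _ }
  have hH : (Measure.map (fun v : Fin N → ℂ => U.1 *ᵥ v) volume).IsAddHaarMeasure :=
    AddEquiv.isAddHaarMeasure_map volume e hc (by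
      show Continuous fun v : Fin N → ℂ => (U⁻¹).1 *ᵥ v
      fun_prop)
  have h := Measure.isAddLeftInvariant_eq_smul
    (Measure.map (fun v : Fin N → ℂ => U.1 *ᵥ v) volume) volume
  set c := Measure.addHaarScalarFactor (Measure.map (fun v : Fin N → ℂ => U.1 *ᵥ v) volume) volume
  have hB := congrArg (fun μ : Measure (Fin N → ℂ) => μ (unitBall N)) h
  have hpre : (fun v : Fin N → ℂ => U.1 *ᵥ v) ⁻¹' unitBall N = unitBall N := by
    ext v; simp only [unitBall, Set.mem_preimage, Set.mem_ofPred_eq, sum_sqAbs_mulVec]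
  simp only [Measure.map_apply hc.measurable measurableSet_unitBall, hpre,
    Measure.smul_apply] at hB
  have hc1 : (c : ℝ≥0∞) = 1 := by
    have : (c : ℝ≥0∞) * volume (unitBall N) = 1 * volume (unitBall N) := by
      rw [one_mul]; exact hB.symm
    exact (ENNReal.mul_left_inj (volume_unitBall_pos N).ne' (volume_unitBall_lt_top N).ne).1 this
  rw [h, ENNReal.coe_eq_one.1 hc1, one_smul]

theorem exists_unitary_col {n : ℕ} {v : Fin (n + 1) → ℂ} (hv : v ≠ 0) :
    ∃ (W : unitaryGroup (Fin (n + 1)) ℂ) (c : ℝ), c ≠ 0 ∧ ∀ i, v i = c * W.1 i 0 := by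
  set w : EuclideanSpace ℂ (Fin (n + 1)) := WithLp.toLp 2 v with hw
  have hw0 : ‖w‖ ≠ 0 := by
    rw [norm_ne_zero_iff]
    intro h
    exact hv (by simpa [hw] using congrArg WithLp.ofLp h)
  have ho : Orthonormal ℂ (({0} : Set (Fin (n + 1))).domRestrict fun _ => ((‖w‖⁻¹ : ℝ) : ℂ) • w) := by
    refine ⟨fun i => ?_, fun i j hij => (hij (Subsingleton.elim i j)).elim⟩
    simp [norm_smul, hw0]
  obtain ⟨b, hb⟩ := ho.exists_orthonormalBasis_extension_of_card_eq (by simp)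
  refine ⟨⟨(EuclideanSpace.basisFun _ ℂ).toBasis.toMatrix b.toBasis,
    (EuclideanSpace.basisFun _ ℂ).toMatrix_orthonormalBasis_mem_unitary b⟩, ‖w‖, hw0, fun i => ?_⟩
  have h0 := hb 0 rfl
  have : (EuclideanSpace.basisFun (Fin (n + 1)) ℂ).toBasis.toMatrix b.toBasis i 0 = b 0 i := by
    simp [Module.Basis.toMatrix_apply]
  simp only [this, h0]
  have hne : (‖w‖ : ℂ) ≠ 0 := by exact_mod_cast hw0
  simp only [WithLp.ofLp_smul, Pi.smul_apply, smul_eq_mul, Complex.ofReal_inv]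
  rw [mul_inv_cancel_left₀ hne, hw]

end RMP

end

noncomputable section

namespace RMP
open Matrix
open scoped ENNReal

/-! ### The law of the first column of a Haar unitary matrix -/

/-- The squared moduli of the coordinates of a vector, normalized to sum to one. -/
def normSqAbs {N : ℕ} (v : Fin N → ℂ) : Fin N → ℝ := fun i => (∑ j, sqAbs v j)⁻¹ * sqAbs v i

theorem measurable_normSqAbs {N : ℕ} : Measurable (normSqAbs (N := N)) := by
  unfold normSqAbs
  have h : ∀ i, Measurable fun v : Fin N → ℂ => sqAbs v i := fun i =>
    (measurable_pi_apply i).comp measurable_sqAbs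
  exact measurable_pi_lambda _ fun i =>
    (Finset.measurable_sum _ fun j _ => h j).inv.mul (h i)

/-- The squared moduli of the first column of a unitary matrix. -/
def colSqAbs {n : ℕ} (U : unitaryGroup (Fin (n + 1)) ℂ) : Fin (n + 1) → ℝ :=
  sqAbs fun i => U.1 i 0

theorem measurable_colSqAbs {n : ℕ} : Measurable (colSqAbs (n := n)) := by
  unfold colSqAbs sqAbs
  have : Continuous fun (U : unitaryGroup (Fin (n + 1)) ℂ) i => ‖U.1 i 0‖ ^ 2 :=
    continuous_pi fun i => ((continuous_subtype_val.matrix_elem i 0).norm.pow 2)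
  exact this.measurable

theorem sum_colSqAbs {n : ℕ} (U : unitaryGroup (Fin (n + 1)) ℂ) : ∑ i, colSqAbs U i = 1 := by
  have h := congrFun (congrFun (conjTranspose_mul_unitary U) 0) 0
  have : ((∑ i, colSqAbs U i : ℝ) : ℂ) = 1 := by
    rw [colSqAbs, sum_sqAbs_eq]
    simpa [mul_apply, dotProduct] using h
  exact_mod_cast this

theorem normSqAbs_mulVec {n : ℕ} {v : Fin (n + 1) → ℂ} {W : unitaryGroup (Fin (n + 1)) ℂ} {c : ℝ}
    (hc : c ≠ 0) (hv : ∀ i, v i = c * W.1 i 0) (U : unitaryGroup (Fin (n + 1)) ℂ) :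
    normSqAbs (U.1 *ᵥ v) = colSqAbs (U * W) := by
  have h : ∀ i, sqAbs (U.1 *ᵥ v) i = c ^ 2 * colSqAbs (U * W) i := by
    intro i
    have : (U.1 *ᵥ v) i = c * (U * W).1 i 0 := by
      simp [mulVec, dotProduct, hv, mul_apply, Finset.mul_sum, mul_left_comm]
    rw [sqAbs, this, colSqAbs, sqAbs, norm_mul, mul_pow, Complex.norm_real, Real.norm_eq_abs, sq_abs]
  funext i
  simp only [normSqAbs, h, ← Finset.mul_sum, sum_colSqAbs]
  field_simp

/-- The direction of a uniform point of the ball is distributed as a Haar column. Rotating by `U`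
leaves the ball integral unchanged. Averaging over `U` first, each fixed `v ≠ 0` is a multiple of
the first column of some unitary `W`, and right invariance removes `W`. -/
theorem lintegral_normSqAbs {n : ℕ} {F : (Fin (n + 1) → ℝ) → ℝ≥0∞} (hF : Measurable F) :
    ∫⁻ v in unitBall (n + 1), F (normSqAbs v) =
      volume (unitBall (n + 1)) * ∫⁻ U, F (colSqAbs U) ∂haarU (n + 1) := by
  have hinv : ∀ U : unitaryGroup (Fin (n + 1)) ℂ, ∫⁻ v in unitBall (n + 1), F (normSqAbs v) =
      ∫⁻ v in unitBall (n + 1), F (normSqAbs (U.1 *ᵥ v)) := by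
    intro U
    have hpre : (fun v : Fin (n + 1) → ℂ => U.1 *ᵥ v) ⁻¹' unitBall (n + 1) = unitBall (n + 1) := by
      ext v; simp only [unitBall, Set.mem_preimage, Set.mem_ofPred_eq, sum_sqAbs_mulVec]
    have h := (measurePreserving_mulVec U).restrict_preimage
      (measurableSet_unitBall (N := n + 1))
    rw [hpre] at h
    exact (h.lintegral_comp (hF.comp measurable_normSqAbs)).symm
  have hm : Measurable (Function.uncurry fun (U : unitaryGroup (Fin (n + 1)) ℂ)
      (v : Fin (n + 1) → ℂ) => F (normSqAbs (U.1 *ᵥ v))) := by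
    have : Continuous fun p : unitaryGroup (Fin (n + 1)) ℂ × (Fin (n + 1) → ℂ) =>
      p.1.1 *ᵥ p.2 := by fun_prop
    exact (hF.comp measurable_normSqAbs).comp this.measurable
  have hin : ∀ v : Fin (n + 1) → ℂ, v ≠ 0 → ∫⁻ U : unitaryGroup (Fin (n + 1)) ℂ,
      F (normSqAbs (U.1 *ᵥ v)) ∂haarU (n + 1) = ∫⁻ U, F (colSqAbs U) ∂haarU (n + 1) := by
    intro v hv
    obtain ⟨W, c, hc, hvW⟩ := exists_unitary_col hv
    simp only [normSqAbs_mulVec hc hvW]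
    exact lintegral_mul_right_eq_self (fun U => F (colSqAbs U)) W
  calc ∫⁻ v in unitBall (n + 1), F (normSqAbs v)
      = ∫⁻ _ : unitaryGroup (Fin (n + 1)) ℂ, (∫⁻ v in unitBall (n + 1), F (normSqAbs v))
          ∂haarU (n + 1) := by simp
    _ = ∫⁻ U : unitaryGroup (Fin (n + 1)) ℂ, (∫⁻ v in unitBall (n + 1), F (normSqAbs (U.1 *ᵥ v)))
          ∂haarU (n + 1) := lintegral_congr fun U => hinv U
    _ = ∫⁻ v in unitBall (n + 1), ∫⁻ U : unitaryGroup (Fin (n + 1)) ℂ,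
          F (normSqAbs (U.1 *ᵥ v)) ∂haarU (n + 1) := lintegral_lintegral_swap hm.aemeasurable
    _ = ∫⁻ v in unitBall (n + 1), ∫⁻ U, F (colSqAbs U) ∂haarU (n + 1) := by
        refine lintegral_congr_ae (ae_restrict_of_ae ?_)
        filter_upwards [compl_mem_ae_iff.2 (measure_singleton (0 : Fin (n + 1) → ℂ))] with v hv
        exact hin v hv
    _ = _ := by
        rw [lintegral_const, Measure.restrict_apply_univ, mul_comm]

theorem map_normSqAbs (n : ℕ) :
    Measure.map normSqAbs (volume.restrict (unitBall (n + 1))) =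
      volume (unitBall (n + 1)) • Measure.map colSqAbs (haarU (n + 1)) := by
  refine Measure.ext_of_lintegral _ fun F hF => ?_
  rw [lintegral_map hF measurable_normSqAbs, lintegral_smul_measure,
    lintegral_map hF measurable_colSqAbs, lintegral_normSqAbs hF, smul_eq_mul]

/-- The open corner of the positive orthant. -/
def openCorner (N : ℕ) : Set (Fin N → ℝ) := {p | (∀ i, 0 < p i) ∧ ∑ i, p i < 1}

theorem measurableSet_openCorner {N : ℕ} : MeasurableSet (openCorner N) := by
  refine MeasurableSet.inter (s₁ := {p : Fin N → ℝ | ∀ i, 0 < p i}) ?_ ?_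
  · have : {p : Fin N → ℝ | ∀ i, 0 < p i} = Set.univ.pi fun _ => Set.Ioi 0 := by ext p; simp
    rw [this]
    exact MeasurableSet.univ_pi fun _ => measurableSet_Ioi
  · exact measurableSet_lt (Finset.measurable_sum _ fun i _ => measurable_pi_apply i)
      measurable_const

theorem ae_sqAbs_mem_openCorner (N : ℕ) :
    ∀ᵐ v ∂(volume.restrict (unitBall N)), sqAbs v ∈ openCorner N := by
  have h : ∀ᵐ p ∂(Measure.map (sqAbs (N := N)) (volume.restrict (unitBall N))),
      p ∈ openCorner N := by
    rw [map_sqAbs_unitBall]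
    exact Measure.ae_smul_measure (ae_restrict_mem measurableSet_openCorner) _
  exact ae_of_ae_map measurable_sqAbs.aemeasurable h

theorem ae_colSqAbs_pos (n : ℕ) : ∀ᵐ U ∂haarU (n + 1), ∀ i, 0 < colSqAbs U i := by
  have hm : MeasurableSet {p : Fin (n + 1) → ℝ | ∀ i, 0 < p i} := by
    have : {p : Fin (n + 1) → ℝ | ∀ i, 0 < p i} = Set.univ.pi fun _ => Set.Ioi 0 := by ext p; simp
    rw [this]
    exact MeasurableSet.univ_pi fun _ => measurableSet_Ioi
  have h : ∀ᵐ p ∂(Measure.map normSqAbs (volume.restrict (unitBall (n + 1)))),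
      p ∈ {p : Fin (n + 1) → ℝ | ∀ i, 0 < p i} := by
    refine (ae_map_iff measurable_normSqAbs.aemeasurable hm).2 ?_
    filter_upwards [ae_sqAbs_mem_openCorner (n + 1)] with v hv i
    exact mul_pos (inv_pos.2 (Finset.sum_pos (fun j _ => hv.1 j) Finset.univ_nonempty)) (hv.1 i)
  rw [map_normSqAbs] at h
  exact ae_of_ae_map measurable_colSqAbs.aemeasurable
    ((Measure.absolutelyContinuous_smul (volume_unitBall_pos _).ne').ae_le h)

/-- Integrating a degree-zero homogeneous function of the squared moduli of the first column. -/
theorem integral_colSqAbs_eq (n : ℕ) : ∃ κ : ℝ, ∀ R : (Fin (n + 1) → ℝ) → ℂ, Measurable R →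
    (∀ (c : ℝ) (p : Fin (n + 1) → ℝ), 0 < c → (∀ i, 0 < p i) → R (fun i => c * p i) = R p) →
    ∫ U, R (colSqAbs U) ∂haarU (n + 1) = κ * ∫ p in openCorner (n + 1), R p := by
  refine ⟨(volume (unitBall (n + 1))).toReal⁻¹ * (ENNReal.ofReal Real.pi ^ (n + 1)).toReal,
    fun R hR hom => ?_⟩
  have h1 : ∫ p, R p ∂(Measure.map normSqAbs (volume.restrict (unitBall (n + 1)))) =
      ∫ p, R p ∂(Measure.map sqAbs (volume.restrict (unitBall (n + 1)))) := by
    rw [integral_map measurable_normSqAbs.aemeasurable hR.aestronglyMeasurable,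
      integral_map measurable_sqAbs.aemeasurable hR.aestronglyMeasurable]
    refine integral_congr_ae ?_
    filter_upwards [ae_sqAbs_mem_openCorner (n + 1)] with v hv
    exact hom _ _ (inv_pos.2 (Finset.sum_pos (fun j _ => hv.1 j) Finset.univ_nonempty)) hv.1
  rw [map_normSqAbs, map_sqAbs_unitBall, integral_smul_measure, integral_smul_measure,
    integral_map measurable_colSqAbs.aemeasurable hR.aestronglyMeasurable] at h1
  have hne : (volume (unitBall (n + 1))).toReal ≠ 0 :=
    (ENNReal.toReal_pos (volume_unitBall_pos _).ne' (volume_unitBall_lt_top _).ne).ne'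
  rw [Complex.real_smul, Complex.real_smul] at h1
  have hne' : ((volume (unitBall (n + 1))).toReal : ℂ) ≠ 0 := by exact_mod_cast hne
  rw [Complex.ofReal_mul, Complex.ofReal_inv, mul_assoc]
  exact (eq_inv_mul_iff_mul_eq₀ hne').2 h1

/-- The law of the interlacing coordinates attached to the first column of a Haar unitary
matrix. -/
theorem exists_integral_haarU_eq_integral_interlacingBox {n : ℕ} {x : Fin (n + 1) → ℝ}
    (hx : StrictMono x) : ∃ κ : ℝ, ∀ (f : (Fin n → ℝ) → ℂ) (G : unitaryGroup (Fin (n + 1)) ℂ → ℂ),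
      Measurable f →
      (∀ U, ∀ b ∈ interlacingBox x, (∀ t : ℝ, ∑ i, colSqAbs U i *
        ∏ j : Fin n, (t - x (i.succAbove j)) = ∏ j, (t - b j)) → G U = f b) →
      ∫ U, G U ∂haarU (n + 1) =
        κ * ∫ b in interlacingBox x, f b * (|(Matrix.vandermonde b).det| : ℝ) := by
  obtain ⟨κ, hκ⟩ := integral_colSqAbs_eq n
  set d : ℝ := |∏ i, (nodeProd x i)⁻¹| * |(Matrix.vandermonde x).det| with hd
  -- The radial variable `r` contributes only a constant. Its value is never needed: the
  -- normalization of spherical functions eliminates it.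
  refine ⟨κ * (d * ∫ r in Set.Ioo (0 : ℝ) 1, |r| ^ n), fun f G hf hG => ?_⟩
  have hemb := measurableEmbedding_of_fderivWithin (measurableSet_interlacingDomain (x := x))
    (fun q _ => (hasFDerivAt_interlacingMap x q).hasFDerivWithinAt) (injOn_interlacingMap hx)
  -- `R` is `f` read as a function of the weights `p`, set to zero off the image. It is measurable
  -- because an injective differentiable map is a measurable embedding.
  set R : (Fin (n + 1) → ℝ) → ℂ := Function.extend ((interlacingDomain x).domRestrict
    (interlacingMap x)) (fun q => f (Fin.tail q.1)) 0 with hRdef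
  have htail : Measurable fun q : Fin (n + 1) → ℝ => Fin.tail q :=
    measurable_pi_lambda _ fun j => measurable_pi_apply j.succ
  have hRm : Measurable R := hemb.measurable_extend
    (hf.comp (htail.comp measurable_subtype_coe)) measurable_const
  have hRT : ∀ q ∈ interlacingDomain x, R (interlacingMap x q) = f (Fin.tail q) := fun q hq =>
    hemb.injective.extend_apply (fun q => f (Fin.tail q.1)) 0 ⟨q, hq⟩
  -- Scaling the weights scales `r` and leaves the roots `b` fixed, so the column may be replaced by
  -- a point of the open corner.
  have hom : ∀ (c : ℝ) (p : Fin (n + 1) → ℝ), 0 < c → (∀ i, 0 < p i) →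
      R (fun i => c * p i) = R p := by
    intro c p hc hp
    obtain ⟨q, hq, rfl⟩ := exists_interlacingMap_eq hx hp
    have hq' : (Fin.cons (c * q 0) (Fin.tail q) : Fin (n + 1) → ℝ) ∈ interlacingDomain x :=
      ⟨by simpa using mul_pos hc hq.1, by simpa using hq.2⟩
    have : (fun i => c * interlacingMap x q i) =
        interlacingMap x (Fin.cons (c * q 0) (Fin.tail q)) := by
      funext i; simp [interlacingMap, Fin.tail, mul_assoc]
    rw [this, hRT _ hq', hRT _ hq, Fin.tail_cons]
  have hGR : ∫ U, G U ∂haarU (n + 1) = ∫ U, R (colSqAbs U) ∂haarU (n + 1) := by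
    refine integral_congr_ae ?_
    filter_upwards [ae_colSqAbs_pos n] with U hU
    obtain ⟨q, hq, hqU⟩ := exists_interlacingMap_eq hx hU
    have h0 : q 0 = 1 := by rw [← sum_interlacingMap hx q, hqU, sum_colSqAbs]
    rw [← hqU, hRT q hq]
    refine hG U _ hq.2 fun t => ?_
    rw [← hqU, ← eval_nodePoly, nodePoly_interlacingMap hx]
    simp [h0, Polynomial.eval_prod, Fin.tail]
  rw [hGR, hκ R hRm hom]
  have hmd : MeasurableSet (interlacingDomain x ∩ {q | q 0 < 1}) :=
    measurableSet_interlacingDomain.inter (measurableSet_lt (measurable_pi_apply 0)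
      measurable_const)
  have hcv := integral_image_eq_integral_abs_det_fderiv_smul volume hmd
    (fun q _ => (hasFDerivAt_interlacingMap x q).hasFDerivWithinAt)
    ((injOn_interlacingMap hx).mono Set.inter_subset_left) R
  rw [image_interlacingMap hx] at hcv
  have hcv2 : ∫ p in openCorner (n + 1), R p = ∫ q in interlacingDomain x ∩ {q | q 0 < 1},
      ((d : ℂ) * ((|q 0| ^ n : ℝ) * (f (Fin.tail q) *
        (|(Matrix.vandermonde (Fin.tail q)).det| : ℝ)))) := by
    refine hcv.trans (setIntegral_congr_fun hmd fun q hq => ?_)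
    have hinj := (strictMono_of_mem_interlacingBox hx hq.1.2).injective
    simp only [LinearMap.det_toContinuousLinearMap, LinearMap.det_toLin',
      abs_det_interlacingJac hinj, hRT q hq.1, Complex.real_smul, ← hd]
    push_cast
    ring
  have hmp := (volume_preserving_piFinSuccAbove (fun _ : Fin (n + 1) => ℝ) 0)
  have hprod : ∫ q in interlacingDomain x ∩ {q | q 0 < 1},
      (((|q 0| ^ n : ℝ) : ℂ) * (f (Fin.tail q) *
        (|(Matrix.vandermonde (Fin.tail q)).det| : ℝ))) =
      (∫ r in Set.Ioo (0 : ℝ) 1, ((|r| ^ n : ℝ) : ℂ)) * ∫ b in interlacingBox x,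
        f b * (|(Matrix.vandermonde b).det| : ℝ) := by
    rw [← setIntegral_prod_mul, ← Measure.volume_eq_prod,
      ← hmp.setIntegral_preimage_emb (MeasurableEquiv.measurableEmbedding _)]
    have hset : (MeasurableEquiv.piFinSuccAbove (fun _ : Fin (n + 1) => ℝ) 0) ⁻¹'
        Set.Ioo (0 : ℝ) 1 ×ˢ interlacingBox x = interlacingDomain x ∩ {q | q 0 < 1} := by
      ext q
      simp [interlacingDomain, Fin.tail_def, and_comm, and_assoc, and_left_comm]
    rw [hset]
    rfl
  rw [hcv2, integral_const_mul, hprod, integral_complex_ofReal]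
  push_cast
  ring

end RMP

end

noncomputable section

namespace RMP
open Matrix
open scoped ComplexOrder

/-! ### Conjugation invariance and the corner of a random unitary conjugate -/

theorem IsHermitian.exists_unitary_conj {n : ℕ} {A : Matrix (Fin n) (Fin n) ℂ}
    (hA : A.IsHermitian) : ∃ V : unitaryGroup (Fin n) ℂ,
      A = V.1ᴴ * diagonal (fun i => (hA.eigenvalues i : ℂ)) * V.1 := by
  refine ⟨hA.eigenvectorUnitary⁻¹, ?_⟩
  have h := hA.spectral_theorem
  rw [Unitary.conjStarAlgAut_apply] at h
  have h2 : ((hA.eigenvectorUnitary⁻¹ : unitaryGroup (Fin n) ℂ) : Matrix (Fin n) (Fin n) ℂ) =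
    star (hA.eigenvectorUnitary : Matrix (Fin n) (Fin n) ℂ) := rfl
  rw [h2, star_eq_conjTranspose, conjTranspose_conjTranspose]
  exact h

/-- Both matrices are unitarily conjugate to the same diagonal matrix, and the average ignores
unitary conjugation. -/
theorem sph_eq_of_charpoly_eq {n : ℕ} {A B : Matrix (Fin n) (Fin n) ℂ} (hA : A.IsHermitian)
    (hB : B.IsHermitian) (h : A.charpoly = B.charpoly) (z : Fin n → ℂ) : sph A z = sph B z := by
  obtain ⟨V, hV⟩ := IsHermitian.exists_unitary_conj hA
  obtain ⟨W, hW⟩ := IsHermitian.exists_unitary_conj hB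
  have he : hA.eigenvalues = hB.eigenvalues := (hA.eigenvalues_eq_eigenvalues_iff hB).2 h
  rw [hV, hW, sph_conj_unitary, sph_conj_unitary, he]

theorem isHermitian_diagonal_ofReal {n : ℕ} (x : Fin n → ℝ) :
    (diagonal fun i => (x i : ℂ)).IsHermitian := by
  rw [IsHermitian, diagonal_conjTranspose]
  congr 1; ext i; simp

theorem posDef_diagonal_ofReal {n : ℕ} {x : Fin n → ℝ} (hx : ∀ i, 0 < x i) :
    (diagonal fun i => (x i : ℂ)).PosDef := by
  rw [posDef_diagonal_iff]
  exact fun i => by exact_mod_cast hx i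

theorem sph_diagonal_perm {n : ℕ} (x : Fin n → ℝ) (σ : Equiv.Perm (Fin n)) (z : Fin n → ℂ) :
    sph (diagonal fun i => (x (σ i) : ℂ)) z = sph (diagonal fun i => (x i : ℂ)) z := by
  refine sph_eq_of_charpoly_eq (isHermitian_diagonal_ofReal fun i => x (σ i))
    (isHermitian_diagonal_ofReal x) ?_ z
  rw [charpoly_diagonal, charpoly_diagonal]
  exact Equiv.prod_comp σ fun i => (Polynomial.X - Polynomial.C (x i : ℂ))

/-- The corner obtained by deleting the first row and column. -/
def corner {n : ℕ} (A : Matrix (Fin (n + 1)) (Fin (n + 1)) ℂ) : Matrix (Fin n) (Fin n) ℂ :=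
  A.submatrix Fin.succ Fin.succ

theorem posDef_corner {n : ℕ} {A : Matrix (Fin (n + 1)) (Fin (n + 1)) ℂ} (hA : A.PosDef) :
    (corner A).PosDef := hA.submatrix (Fin.succ_injective n)

/-- The block matrix `diag(1, V)`. -/
def oneBlock {n : ℕ} (V : Matrix (Fin n) (Fin n) ℂ) : Matrix (Fin (n + 1)) (Fin (n + 1)) ℂ :=
  Matrix.of (Fin.cons (Pi.single 0 1) fun i => Fin.cons 0 (V i))

theorem corner_oneBlock_conj {n : ℕ} (V : Matrix (Fin n) (Fin n) ℂ)
    (A : Matrix (Fin (n + 1)) (Fin (n + 1)) ℂ) :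
    corner ((oneBlock V)ᴴ * A * oneBlock V) = Vᴴ * corner A * V := by
  ext i j
  simp [corner, oneBlock, mul_apply, Fin.sum_univ_succ]

theorem oneBlock_mem_unitary {n : ℕ} (V : unitaryGroup (Fin n) ℂ) :
    oneBlock V.1 ∈ unitaryGroup (Fin (n + 1)) ℂ := by
  rw [mem_unitaryGroup_iff', star_eq_conjTranspose]
  have h := conjTranspose_mul_unitary V
  ext i j
  refine Fin.cases ?_ (fun i => ?_) i <;> refine Fin.cases ?_ (fun j => ?_) j
  · simp [oneBlock, mul_apply, Fin.sum_univ_succ]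
  · simp [oneBlock, mul_apply, Fin.sum_univ_succ, (Fin.succ_ne_zero _).symm]
  · simp [oneBlock, mul_apply, Fin.sum_univ_succ]
  · have h2 := congrFun (congrFun h i) j
    simp only [mul_apply, conjTranspose_apply, one_apply] at h2
    simpa [oneBlock, mul_apply, Fin.sum_univ_succ, one_apply] using h2

/-- The recursion behind Gelfand-Naimark. The full determinant is invariant under unitary
conjugation and comes out. Right translation by `diag(1, V)` conjugates the corner by `V`, so
averaging over `V` turns its `minorPow` into `sph`. -/
theorem sph_succ {n : ℕ} {A : Matrix (Fin (n + 1)) (Fin (n + 1)) ℂ} (hA : A.PosDef)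
    (z : Fin (n + 1) → ℂ) :
    sph A z = Complex.exp (z 0 * (Real.log A.det.re : ℂ)) *
      ∫ U : unitaryGroup (Fin (n + 1)) ℂ, sph (corner (U.1ᴴ * A * U.1))
        (fun i => z i.succ - z 0 - 1) ∂haarU (n + 1) := by
  set w : Fin n → ℂ := fun i => z i.succ - z 0 - 1 with hw
  have hdet : ∀ U : unitaryGroup (Fin (n + 1)) ℂ, (U.1ᴴ * A * U.1).det = A.det := by
    intro U
    rw [det_mul, det_mul, mul_comm, ← mul_assoc, ← det_mul, ← star_eq_conjTranspose,
      mem_unitaryGroup_iff.1 U.2, det_one, one_mul]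
  have h1 : sph A z = Complex.exp (z 0 * (Real.log A.det.re : ℂ)) *
      ∫ U : unitaryGroup (Fin (n + 1)) ℂ, minorPow n (corner (U.1ᴴ * A * U.1)) w
        ∂haarU (n + 1) := by
    rw [← integral_const_mul, sph]
    congr 1; ext U
    rw [minorPow, hdet]
    rfl
  rw [h1]
  congr 1
  have hV : ∀ V : unitaryGroup (Fin n) ℂ, ∫ U : unitaryGroup (Fin (n + 1)) ℂ,
      minorPow n (V.1ᴴ * corner (U.1ᴴ * A * U.1) * V.1) w ∂haarU (n + 1) =
      ∫ U : unitaryGroup (Fin (n + 1)) ℂ, minorPow n (corner (U.1ᴴ * A * U.1)) w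
        ∂haarU (n + 1) := by
    intro V
    rw [← integral_mul_right_eq_self (fun U : unitaryGroup (Fin (n + 1)) ℂ =>
      minorPow n (corner (U.1ᴴ * A * U.1)) w) ⟨oneBlock V.1, oneBlock_mem_unitary V⟩]
    congr 1; ext U
    rw [← corner_oneBlock_conj]
    simp [conjTranspose_mul, Matrix.mul_assoc]
  calc ∫ U : unitaryGroup (Fin (n + 1)) ℂ, minorPow n (corner (U.1ᴴ * A * U.1)) w
        ∂haarU (n + 1)
      = ∫ V : unitaryGroup (Fin n) ℂ, ∫ U : unitaryGroup (Fin (n + 1)) ℂ,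
          minorPow n (V.1ᴴ * corner (U.1ᴴ * A * U.1) * V.1) w ∂haarU (n + 1) ∂haarU n := by
        simp [hV]
    _ = _ := by
        unfold sph
        refine integral_integral_swap ?_
        have hc : Continuous (Function.uncurry fun (V : unitaryGroup (Fin n) ℂ)
            (U : unitaryGroup (Fin (n + 1)) ℂ) =>
            minorPow n (V.1ᴴ * corner (U.1ᴴ * A * U.1) * V.1) w) := by
          refine continuous_minorPow n _ _ ?_ continuous_const fun p =>
            posDef_conj_of_isUnit (posDef_corner (posDef_conj_of_isUnit hA (isUnit_unitary p.2)))
              (isUnit_unitary p.1)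
          unfold corner
          fun_prop
        rw [← integrableOn_univ]
        exact hc.continuousOn.integrableOn_compact isCompact_univ

/-- The characteristic polynomial of the corner is the top left entry of the adjugate of `Uᴴ (t -
diag x) U`, which equals `∑ |U_{i0}|² ∏_{l ≠ i} (t - x_l)`. So the corner has as eigenvalues the
interlacing coordinates of the first column. -/
theorem charpoly_corner_eq {n : ℕ} {x : Fin (n + 1) → ℝ} {U : unitaryGroup (Fin (n + 1)) ℂ}
    {b : Fin n → ℝ} (h : ∀ t : ℝ, ∑ i, colSqAbs U i * ∏ j : Fin n, (t - x (i.succAbove j)) =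
      ∏ j, (t - b j)) :
    (corner (U.1ᴴ * diagonal (fun i => (x i : ℂ)) * U.1)).charpoly =
      (diagonal fun i => (b i : ℂ)).charpoly := by
  rw [charpoly_diagonal]
  refine Polynomial.eq_of_infinite_eval_eq _ _ (Set.Infinite.mono ?_
    (Set.infinite_range_of_injective Complex.ofReal_injective))
  rintro _ ⟨t, rfl⟩
  have h1 : scalar (Fin n) (t : ℂ) - corner (U.1ᴴ * diagonal (fun i => (x i : ℂ)) * U.1) =
      corner (U.1ᴴ * diagonal (fun i => ((t : ℂ) - x i)) * U.1) := by
    have hd : diagonal (fun i => ((t : ℂ) - x i)) = (t : ℂ) • (1 : Matrix (Fin (n + 1)) _ ℂ) -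
        diagonal (fun i => (x i : ℂ)) := by
      rw [smul_one_eq_diagonal, diagonal_sub]
    rw [hd, mul_sub, sub_mul, Matrix.mul_smul, mul_one, Matrix.smul_mul,
      conjTranspose_mul_unitary]
    ext i j
    simp [corner, one_apply, diagonal_apply]
  have h2 : ∀ A : Matrix (Fin (n + 1)) (Fin (n + 1)) ℂ, (corner A).det = A.adjugate 0 0 := by
    intro A
    rw [adjugate_fin_succ_eq_det_submatrix]
    simp [corner]
  have hUU : U.1 * U.1ᴴ = 1 := by
    simpa [star_eq_conjTranspose] using mem_unitaryGroup_iff.1 U.2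
  have h4 : (U.1ᴴ * diagonal (fun i => ((t : ℂ) - x i)) * U.1).adjugate =
      U.1ᴴ * (diagonal (fun i => ((t : ℂ) - x i))).adjugate * U.1 := by
    have e1 : U.1.adjugate = U.1.det • U.1ᴴ := by
      calc U.1.adjugate = U.1.adjugate * (U.1 * U.1ᴴ) := by rw [hUU, mul_one]
        _ = _ := by rw [← Matrix.mul_assoc, adjugate_mul, Matrix.smul_mul, one_mul]
    have e2 : U.1ᴴ.adjugate = U.1ᴴ.det • U.1 := by
      calc U.1ᴴ.adjugate = (U.1 * U.1ᴴ) * U.1ᴴ.adjugate := by rw [hUU, one_mul]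
        _ = _ := by rw [Matrix.mul_assoc, mul_adjugate, Matrix.mul_smul, mul_one]
    have e3 : U.1ᴴ.det * U.1.det = 1 := by
      rw [← det_mul, conjTranspose_mul_unitary, det_one]
    rw [adjugate_mul_distrib, adjugate_mul_distrib, e1, e2]
    simp only [Matrix.smul_mul, Matrix.mul_smul, smul_smul, e3, one_smul, Matrix.mul_assoc]
  show Polynomial.eval _ _ = Polynomial.eval _ _
  rw [eval_charpoly, h1, h2, h4, adjugate_diagonal]
  have h5 := congrArg (fun r : ℝ => (r : ℂ)) (h t)
  simp only [Complex.ofReal_sum, Complex.ofReal_mul, Complex.ofReal_prod, Complex.ofReal_sub] at h5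
  simp only [Polynomial.eval_prod, Polynomial.eval_sub, Polynomial.eval_X, Polynomial.eval_C]
  rw [← h5]
  rw [mul_apply]
  refine Finset.sum_congr rfl fun i _ => ?_
  have h6 : ∏ j ∈ Finset.univ.erase i, ((t : ℂ) - x j) =
      ∏ j : Fin n, ((t : ℂ) - x (i.succAbove j)) := by
    rw [Fin.univ_succAbove n i, Finset.erase_cons, Finset.prod_map]
    rfl
  rw [mul_diagonal, conjTranspose_apply, h6, colSqAbs, sqAbs, Complex.ofReal_pow, ← Complex.conj_mul']
  simp only [Complex.star_def]
  ring

end RMP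

end

noncomputable section

namespace RMP
open Matrix
open scoped ComplexOrder

/-! ### The Gelfand-Naimark formula -/

/-- `det [exp(z_i a_j)]`. -/
def expDet {N : ℕ} (a : Fin N → ℝ) (z : Fin N → ℂ) : ℂ :=
  (Matrix.of fun i j : Fin N => Complex.exp (z i * (a j : ℂ))).det

theorem multivariateBessel_eq {N : ℕ} (a : Fin N → ℝ) (z : Fin N → ℂ) :
    multivariateBessel a z = expDet a z / vandermonde z := rfl

theorem vandermonde_eq_det {N : ℕ} (z : Fin N → ℂ) :
    vandermonde z = (Matrix.vandermonde fun i => -z i).det := by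
  rw [det_vandermonde, vandermonde]
  refine Finset.prod_congr rfl fun i _ => Finset.prod_congr rfl fun j _ => ?_
  ring

theorem vandermonde_comp_perm {N : ℕ} (z : Fin N → ℂ) (σ : Equiv.Perm (Fin N)) :
    vandermonde (z ∘ σ) = Equiv.Perm.sign σ * vandermonde z := by
  rw [vandermonde_eq_det, vandermonde_eq_det, ← det_permute]
  rfl

theorem vandermonde_ne_zero_iff {N : ℕ} (z : Fin N → ℂ) :
    vandermonde z ≠ 0 ↔ Function.Injective z := by
  rw [vandermonde_eq_det, det_vandermonde_ne_zero_iff]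
  exact ⟨fun h i j hij => h (by simp [hij]), fun h i j hij => h (neg_injective hij)⟩

theorem expDet_comp_perm {N : ℕ} (a : Fin N → ℝ) (z : Fin N → ℂ) (σ : Equiv.Perm (Fin N)) :
    expDet a (z ∘ σ) = Equiv.Perm.sign σ * expDet a z := by
  rw [expDet, expDet, ← det_permute]
  rfl

theorem expDet_perm_left {N : ℕ} (a : Fin N → ℝ) (z : Fin N → ℂ) (σ : Equiv.Perm (Fin N)) :
    expDet (a ∘ σ) z = Equiv.Perm.sign σ * expDet a z := by
  rw [expDet, expDet, ← det_permute']
  rfl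

theorem sign_ne_zero {N : ℕ} (σ : Equiv.Perm (Fin N)) :
    ((Equiv.Perm.sign σ : ℤ) : ℂ) ≠ 0 := by
  exact_mod_cast (Equiv.Perm.sign σ).ne_zero

theorem multivariateBessel_comp_perm {N : ℕ} (a : Fin N → ℝ) (z : Fin N → ℂ)
    (σ : Equiv.Perm (Fin N)) : multivariateBessel a (z ∘ σ) = multivariateBessel a z := by
  rw [multivariateBessel_eq, multivariateBessel_eq, expDet_comp_perm, vandermonde_comp_perm,
    mul_div_mul_left _ _ (sign_ne_zero σ)]

/-- `(0, 1, …, N - 1)`. -/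
def revRho (N : ℕ) : Fin N → ℂ := fun i => ((i : ℕ) : ℂ)

theorem multivariateBessel_rho {N : ℕ} (a : Fin N → ℝ) :
    multivariateBessel a (rho N) = multivariateBessel a (revRho N) := by
  rw [← multivariateBessel_comp_perm a (revRho N) Fin.revPerm]
  congr 1
  funext i
  simp only [rho, revRho, Function.comp_apply, Fin.revPerm_apply, Fin.val_rev]
  rw [Nat.cast_sub (by omega)]
  push_cast
  ring

/-- At `(0, 1, …, n - 1)` all exponents `z 0` and `z i.succ - z i - 1` vanish. The shift by one in
`minorPow` places the trivial spherical function at this point. -/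
theorem minorPow_revRho : ∀ (n : ℕ) (A : Matrix (Fin n) (Fin n) ℂ), minorPow n A (revRho n) = 1
  | 0, _ => rfl
  | n + 1, A => by
    rw [minorPow]
    have : (fun i : Fin n => revRho (n + 1) i.succ - revRho (n + 1) 0 - 1) = revRho n := by
      funext i; simp [revRho]
    rw [this, minorPow_revRho n]
    simp [revRho]

theorem sph_revRho {n : ℕ} (A : Matrix (Fin n) (Fin n) ℂ) : sph A (revRho n) = 1 := by
  simp [sph, minorPow_revRho]

theorem revRho_injective (n : ℕ) : Function.Injective (revRho n) := fun i j h => by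
  simpa [revRho, Fin.ext_iff] using h

theorem rho_injective (n : ℕ) : Function.Injective (rho n) := fun i j h => by
  simpa [rho, Fin.ext_iff] using h

theorem expDet_log_revRho {n : ℕ} {b : Fin n → ℝ} (hb : ∀ i, 0 < b i) :
    expDet (fun j => Real.log (b j)) (revRho n) = ((Matrix.vandermonde b).det : ℝ) := by
  have : ((Matrix.vandermonde b).det : ℂ) = (Matrix.vandermonde fun i => (b i : ℂ)).det := by
    rw [det_vandermonde, det_vandermonde]
    push_cast
    rfl
  rw [this, ← det_transpose, expDet]
  congr 1
  ext i j
  simp only [of_apply, revRho, transpose_apply, Matrix.vandermonde]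
  rw [Complex.exp_nat_mul, ← Complex.ofReal_exp, Real.exp_log (hb j)]

theorem det_vandermonde_pos {n : ℕ} {b : Fin n → ℝ} (hb : StrictMono b) :
    0 < (Matrix.vandermonde b).det := by
  rw [det_vandermonde]
  exact Finset.prod_pos fun i _ => Finset.prod_pos fun j hj =>
    sub_pos.2 (hb (Finset.mem_Ioi.1 hj))

theorem integral_exp_mul_log {a b : ℝ} (ha : 0 < a) (hab : a < b) {u : ℂ} (hu : u ≠ 0) :
    ∫ t in Set.Ioo a b, Complex.exp ((u - 1) * (Real.log t : ℂ)) =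
      u⁻¹ * (Complex.exp (u * (Real.log b : ℂ)) - Complex.exp (u * (Real.log a : ℂ))) := by
  have hcp : ∀ t : ℝ, 0 < t → ∀ w : ℂ, (t : ℂ) ^ w = Complex.exp (w * (Real.log t : ℂ)) := by
    intro t ht w
    rw [Complex.cpow_def_of_ne_zero (by exact_mod_cast ht.ne'), Complex.ofReal_log ht.le, mul_comm]
  have h0 : (0 : ℝ) ∉ Set.uIcc a b := by
    rw [Set.uIcc_of_le hab.le]
    exact fun h => absurd h.1 (not_le.2 ha)
  have h := integral_cpow (a := a) (b := b) (r := u - 1) (Or.inr ⟨by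
    intro h; apply hu; linear_combination h, h0⟩)
  rw [intervalIntegral.integral_of_le hab.le, integral_Ioc_eq_integral_Ioo, sub_add_cancel,
    hcp a ha, hcp b (ha.trans hab)] at h
  rw [inv_mul_eq_div, ← h]
  exact setIntegral_congr_fun measurableSet_Ioo fun t ht => (hcp t (ha.trans ht.1) _).symm

theorem integrableOn_exp_mul_log {a b : ℝ} (ha : 0 < a) (w : ℂ) :
    IntegrableOn (fun t : ℝ => Complex.exp (w * (Real.log t : ℂ))) (Set.Ioo a b) := by
  refine IntegrableOn.mono_set (t := Set.Icc a b) ?_ Set.Ioo_subset_Icc_self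
  refine ContinuousOn.integrableOn_compact isCompact_Icc ?_
  refine Complex.continuous_exp.comp_continuousOn (continuousOn_const.mul
    (Complex.continuous_ofReal.comp_continuousOn (Real.continuousOn_log.mono fun t ht => ?_)))
  exact (ha.trans_le ht.1).ne'

/-- Integrating an alternating sum of exponentials over the interlacing box. -/
theorem integral_interlacingBox_expDet {n : ℕ} {x : Fin (n + 1) → ℝ} (hx : StrictMono x)
    (hpos : ∀ i, 0 < x i) {u : Fin n → ℂ} (hu : ∀ i, u i ≠ 0) :
    ∫ b in interlacingBox x, expDet (fun j => Real.log (b j)) (fun i => u i - 1) =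
      (∏ i, (u i)⁻¹) * (Matrix.of fun i j : Fin n => Complex.exp (u i * (Real.log (x j.succ) : ℂ)) -
        Complex.exp (u i * (Real.log (x j.castSucc) : ℂ))).det := by
  have hmu : (volume : Measure (Fin n → ℝ)).restrict (interlacingBox x) =
      Measure.pi fun j : Fin n => volume.restrict (Set.Ioo (x j.castSucc) (x j.succ)) := by
    rw [interlacingBox, volume_pi, Measure.restrict_pi_pi]
  rw [hmu]
  -- In the Leibniz expansion every term is a product of one-variable functions, and the box is a
  -- product of intervals, so each term integrates coordinate by coordinate.
  simp only [expDet, det_apply, of_apply]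
  rw [integral_finsetSum]
  · have : ∀ σ : Equiv.Perm (Fin n), ∫ b : Fin n → ℝ, Equiv.Perm.sign σ •
        ∏ j, Complex.exp ((u (σ j) - 1) * (Real.log (b j) : ℂ)) ∂(Measure.pi fun j : Fin n =>
          volume.restrict (Set.Ioo (x j.castSucc) (x j.succ))) =
        (∏ i, (u i)⁻¹) * (Equiv.Perm.sign σ • ∏ j, (Complex.exp (u (σ j) *
          (Real.log (x j.succ) : ℂ)) - Complex.exp (u (σ j) * (Real.log (x j.castSucc) : ℂ)))) := by
      intro σ
      simp only [Units.smul_def, zsmul_eq_mul]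
      rw [integral_const_mul, integral_fintype_prod_eq_prod (fun (j : Fin n) (t : ℝ) =>
        Complex.exp ((u (σ j) - 1) * (Real.log t : ℂ))), ← Equiv.prod_comp σ fun i => (u i)⁻¹,
        mul_left_comm, ← Finset.prod_mul_distrib]
      congr 1
      exact Finset.prod_congr rfl fun j _ => integral_exp_mul_log (hpos _)
        (hx (by simp [Fin.lt_def])) (hu _)
    simp only [this, Finset.mul_sum]
  · intro σ _
    simp only [Units.smul_def, zsmul_eq_mul]
    refine Integrable.const_mul ?_ _
    exact Integrable.fintype_prod (f := fun (j : Fin n) (t : ℝ) =>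
        Complex.exp ((u (σ j) - 1) * (Real.log t : ℂ))) fun j => integrableOn_exp_mul_log (hpos _) _

/-- Factoring `exp(z_0 a_j)` out of each column makes the first row constant; subtracting adjacent
columns then turns it into `(1, 0, …, 0)`. -/
theorem expDet_eq_det_differences {n : ℕ} (a : Fin (n + 1) → ℝ) (z : Fin (n + 1) → ℂ) :
    expDet a z = Complex.exp (z 0 * ((∑ j, a j : ℝ) : ℂ)) *
      (Matrix.of fun i j : Fin n => Complex.exp ((z i.succ - z 0) * (a j.succ : ℂ)) -
        Complex.exp ((z i.succ - z 0) * (a j.castSucc : ℂ))).det := by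
  set A : Matrix (Fin (n + 1)) (Fin (n + 1)) ℂ :=
    Matrix.of fun i j => Complex.exp ((z i - z 0) * (a j : ℂ)) with hA
  have h1 : expDet a z = Complex.exp (z 0 * ((∑ j, a j : ℝ) : ℂ)) * A.det := by
    have : (Matrix.of fun i j : Fin (n + 1) => Complex.exp (z i * (a j : ℂ))) =
        A * diagonal fun j => Complex.exp (z 0 * (a j : ℂ)) := by
      ext i j
      rw [mul_diagonal, hA, of_apply, of_apply, ← Complex.exp_add]
      congr 1; ring
    rw [expDet, this, det_mul, det_diagonal, ← Complex.exp_sum, mul_comm]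
    push_cast
    rw [Finset.mul_sum]
  set B : Matrix (Fin (n + 1)) (Fin (n + 1)) ℂ := Matrix.of fun i => Fin.cons (A i 0)
    fun j : Fin n => A i j.succ - A i j.castSucc with hB
  have h2 : A.det = B.det :=
    det_eq_of_forall_col_eq_smul_add_pred (fun _ => 1) (fun i => by simp [hB])
      fun i j => by simp [hB]
  have h3 : B.det = (Matrix.of fun i j : Fin n => Complex.exp ((z i.succ - z 0) * (a j.succ : ℂ)) -
        Complex.exp ((z i.succ - z 0) * (a j.castSucc : ℂ))).det := by
    rw [det_succ_row_zero, Fin.sum_univ_succ, Finset.sum_eq_zero, add_zero]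
    · have h0 : B 0 0 = 1 := by simp [hB, hA]
      rw [h0, Fin.val_zero, pow_zero, one_mul, one_mul]
      rfl
    · intro j _
      have h0 : B 0 j.succ = 0 := by simp [hB, hA]
      rw [h0, mul_zero, zero_mul]
  rw [h1, h2, h3]

theorem measurable_multivariateBessel_log {n : ℕ} (z : Fin n → ℂ) :
    Measurable fun b : Fin n → ℝ => multivariateBessel (fun j => Real.log (b j)) z := by
  unfold multivariateBessel
  refine Measurable.div_const ?_ _
  simp only [det_apply]
  refine Finset.measurable_sum _ fun σ _ => Measurable.const_smul (Finset.measurable_prod _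
    fun j _ => ?_) _
  exact Complex.measurable_exp.comp (measurable_const.mul (Complex.measurable_ofReal.comp
    (Real.measurable_log.comp (measurable_pi_apply j))))

theorem vandermonde_succ {n : ℕ} (z : Fin (n + 1) → ℂ) :
    vandermonde z = (∏ j : Fin n, (z 0 - z j.succ)) * vandermonde fun i => z i.succ - z 0 - 1 := by
  rw [vandermonde, vandermonde, Fin.prod_univ_succ]
  simp [Fin.prod_Ioi_succ]

/-- Induction on the size: `sph_succ` reduces to the corner, whose eigenvalues have density
proportional to `|V(b)|` on the interlacing box, and the induction hypothesis makes the integrand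
explicit. -/
theorem sph_diagonal_of_strictMono : ∀ (n : ℕ) (x : Fin n → ℝ), StrictMono x → (∀ i, 0 < x i) →
    ∀ z : Fin n → ℂ, Function.Injective z → sph (diagonal fun i => (x i : ℂ)) z =
      multivariateBessel (fun j => Real.log (x j)) z /
        multivariateBessel (fun j => Real.log (x j)) (revRho n)
  | 0, x, _, _, z, _ => by
    have hz : z = revRho 0 := Subsingleton.elim _ _
    rw [hz, sph_revRho, div_self]
    simp [multivariateBessel, vandermonde]
  | n + 1, x, hx, hpos, z, hz => by
    obtain ⟨κ, hκ⟩ := exists_integral_haarU_eq_integral_interlacingBox hx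
    -- The formula up to a factor independent of `z`; comparison with `revRho`, where `sph` equals
    -- 1, removes the unknown `κ`.
    have main : ∀ z : Fin (n + 1) → ℂ, Function.Injective z →
        sph (diagonal fun i => (x i : ℂ)) z * vandermonde z =
        (κ * vandermonde (revRho n) * (-1) ^ n) * expDet (fun j => Real.log (x j)) z := by
      intro z hz
      set w : Fin n → ℂ := fun i => z i.succ - z 0 - 1 with hw
      have hwi : Function.Injective w := fun i j h => by
        have : z i.succ = z j.succ := by simpa [hw] using h
        exact Fin.succ_injective n (hz this)
      have hu : ∀ i : Fin n, z i.succ - z 0 ≠ 0 := fun i =>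
        sub_ne_zero.2 (hz.ne (Fin.succ_ne_zero i))
      have hbpos : ∀ b ∈ interlacingBox x, ∀ i, 0 < b i := fun b hb i =>
        (hpos _).trans ((mem_interlacingBox.1 hb) i).1
      have hint := hκ (fun b => multivariateBessel (fun j => Real.log (b j)) w /
        multivariateBessel (fun j => Real.log (b j)) (revRho n))
        (fun U => sph (corner (U.1ᴴ * diagonal (fun i => (x i : ℂ)) * U.1)) w)
        ((measurable_multivariateBessel_log w).div (measurable_multivariateBessel_log _))
        (fun U b hb h => by
          rw [← sph_diagonal_of_strictMono n b (strictMono_of_mem_interlacingBox hx hb)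
            (hbpos b hb) w hwi]
          exact sph_eq_of_charpoly_eq
            (posDef_corner (posDef_conj_of_isUnit (posDef_diagonal_ofReal hpos)
              (isUnit_unitary U))).isHermitian
            (isHermitian_diagonal_ofReal b) (charpoly_corner_eq h) w)
      -- The numerator of the Bessel function at `revRho` is the Vandermonde determinant of `b`, so
      -- it cancels the density and leaves a pure determinant of exponentials.
      have hbox : ∫ b in interlacingBox x, multivariateBessel (fun j => Real.log (b j)) w /
          multivariateBessel (fun j => Real.log (b j)) (revRho n) *
            (|(Matrix.vandermonde b).det| : ℝ) =
          vandermonde (revRho n) / vandermonde w *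
            ∫ b in interlacingBox x, expDet (fun j => Real.log (b j)) w := by
        rw [← integral_const_mul]
        refine setIntegral_congr_fun measurableSet_interlacingBox fun b hb => ?_
        have hV := det_vandermonde_pos (strictMono_of_mem_interlacingBox hx hb)
        have hV' : ((Matrix.vandermonde b).det : ℂ) ≠ 0 := by exact_mod_cast hV.ne'
        have h1 := (vandermonde_ne_zero_iff _).2 hwi
        have h2 := (vandermonde_ne_zero_iff _).2 (revRho_injective n)
        simp only [multivariateBessel_eq, expDet_log_revRho (hbpos b hb), abs_of_pos hV]
        field_simp
      rw [hbox, integral_interlacingBox_expDet hx hpos hu] at hint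
      rw [sph_succ (posDef_diagonal_ofReal hpos), hint, det_diagonal, expDet_eq_det_differences,
        vandermonde_succ z]
      have h1 := (vandermonde_ne_zero_iff _).2 hwi
      have hlog : Real.log (∏ i, (x i : ℂ)).re = ∑ j, Real.log (x j) := by
        rw [← Complex.ofReal_prod, Complex.ofReal_re, Real.log_prod fun i _ => (hpos i).ne']
      have hprod : ∏ j : Fin n, (z 0 - z j.succ) = (-1) ^ n * ∏ j : Fin n, (z j.succ - z 0) := by
        calc ∏ j : Fin n, (z 0 - z j.succ) = ∏ j : Fin n, (-1 * (z j.succ - z 0)) :=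
              Finset.prod_congr rfl fun j _ => by ring
          _ = _ := by
              rw [Finset.prod_mul_distrib, Finset.prod_const, Finset.card_univ, Fintype.card_fin]
      have hne : ∏ j : Fin n, (z j.succ - z 0) ≠ 0 := Finset.prod_ne_zero_iff.2 fun j _ => hu j
      rw [hlog, hprod, Finset.prod_inv_distrib]
      field_simp
      rw [hw]
      ring
    have e1 := main z hz
    have e2 := main (revRho (n + 1)) (revRho_injective _)
    rw [sph_revRho, one_mul] at e2
    have h1 := (vandermonde_ne_zero_iff _).2 hz
    have h2 := (vandermonde_ne_zero_iff _).2 (revRho_injective (n + 1))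
    have h3 : expDet (fun j => Real.log (x j)) (revRho (n + 1)) ≠ 0 := fun h => by
      rw [h, mul_zero] at e2; exact h2 e2
    rw [multivariateBessel_eq, multivariateBessel_eq]
    field_simp
    rw [e1, e2]
    ring

/-- **Gelfand-Naimark formula** for the spherical functions of `GL(N, ℂ)`. -/
theorem sph_diagonal_exp {n : ℕ} {a : Fin n → ℝ} (ha : Function.Injective a) {z : Fin n → ℂ}
    (hz : Function.Injective z) : sph (diagonal fun i => (Real.exp (a i) : ℂ)) z =
      multivariateBessel a z / multivariateBessel a (rho n) := by
  set σ := Tuple.sort a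
  have hmono : StrictMono (a ∘ σ) :=
    (Tuple.monotone_sort a).strictMono_of_injective (ha.comp σ.injective)
  have h := sph_diagonal_of_strictMono n (fun i => Real.exp (a (σ i)))
    (Real.exp_strictMono.comp hmono) (fun i => Real.exp_pos _) z hz
  rw [sph_diagonal_perm (fun i => Real.exp (a i)) σ z] at h
  rw [h, multivariateBessel_rho]
  simp only [Real.log_exp, multivariateBessel_eq]
  have e : (fun j => a (σ j)) = a ∘ σ := rfl
  rw [e, expDet_perm_left, expDet_perm_left, mul_div_assoc _ (expDet a z),
    mul_div_assoc _ (expDet a (revRho n)),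
    mul_div_mul_left _ _ (sign_ne_zero σ)]

end RMP

end

noncomputable section

namespace RMP
open Matrix Filter Topology
open scoped ComplexOrder

/-! ### Normalized Bessel functions as spherical functions -/

/-- A line whose direction has distinct coordinates meets each hyperplane `z_i = z_j` at most once.
-/
theorem finite_setOf_not_injective {ι 𝕜 : Type*} [Finite ι] [Field 𝕜] (z : ι → 𝕜) {d : ι → 𝕜}
    (hd : Function.Injective d) : {s : 𝕜 | ¬ Function.Injective fun i => z i + s * d i}.Finite := by
  have h : {s : 𝕜 | ¬ Function.Injective fun i => z i + s * d i} ⊆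
      ⋃ p : ι × ι, {s | p.1 ≠ p.2 ∧ z p.1 + s * d p.1 = z p.2 + s * d p.2} := by
    intro s hs
    simp only [Set.mem_ofPred_eq, Function.Injective, not_forall] at hs
    obtain ⟨i, j, hij, hne⟩ := hs
    exact Set.mem_iUnion.2 ⟨(i, j), hne, hij⟩
  refine Set.Finite.subset (Set.finite_iUnion fun p => Set.Subsingleton.finite ?_) h
  rintro s ⟨hne, hs⟩ t ⟨-, ht⟩
  have hd' : d p.1 - d p.2 ≠ 0 := sub_ne_zero.2 (hd.ne hne)
  have : (s - t) * (d p.1 - d p.2) = 0 := by linear_combination hs - ht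
  exact sub_eq_zero.1 ((mul_eq_zero.1 this).resolve_right hd')

theorem dense_setOf_injective {N : ℕ} (𝕜 : Type*) [NontriviallyNormedField 𝕜] [CharZero 𝕜] :
    Dense {z : Fin N → 𝕜 | Function.Injective z} := by
  intro z
  have hd : Function.Injective fun i : Fin N => ((i : ℕ) : 𝕜) := fun i j h => by
    simpa [Fin.ext_iff] using h
  have hfin := finite_setOf_not_injective z hd
  have hcont : Continuous fun (s : 𝕜) (i : Fin N) => z i + s * ((i : ℕ) : 𝕜) := by fun_prop
  have htend : Tendsto (fun (s : 𝕜) (i : Fin N) => z i + s * ((i : ℕ) : 𝕜)) (𝓝[≠] 0) (𝓝 z) := by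
    have := hcont.tendsto 0
    simp only [zero_mul, add_zero] at this
    exact this.mono_left nhdsWithin_le_nhds
  refine mem_closure_of_tendsto htend ?_
  have hcl : IsClosed ({s : 𝕜 | ¬ Function.Injective fun i => z i + s * ((i : ℕ) : 𝕜)} \ {0}) :=
    (hfin.subset Set.sdiff_subset).isClosed
  have hmem : ({s : 𝕜 | ¬ Function.Injective fun i => z i + s * ((i : ℕ) : 𝕜)} \ {0})ᶜ ∈ 𝓝 (0 : 𝕜) :=
    hcl.isOpen_compl.mem_nhds fun h => h.2 rfl
  filter_upwards [mem_nhdsWithin_of_mem_nhds hmem, self_mem_nhdsWithin] with s hs hs0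
  by_contra hcon
  exact hs ⟨hcon, hs0⟩

/-- The spherical function with parameter `exp a`. -/
def sphExp {N : ℕ} (a : Fin N → ℝ) (z : Fin N → ℂ) : ℂ :=
  sph (diagonal fun i => (Real.exp (a i) : ℂ)) z

theorem continuous_sphExp {N : ℕ} :
    Continuous fun p : (Fin N → ℝ) × (Fin N → ℂ) => sphExp p.1 p.2 := by
  refine continuous_sph (A := fun p : (Fin N → ℝ) × (Fin N → ℂ) =>
    diagonal fun i => (Real.exp (p.1 i) : ℂ)) ?_ continuous_snd fun p =>
    posDef_diagonal_ofReal fun i => Real.exp_pos _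
  refine Continuous.matrix_diagonal (continuous_pi fun i => ?_)
  exact Complex.continuous_ofReal.comp
    (Real.continuous_exp.comp ((continuous_apply i).comp continuous_fst))

theorem continuous_sphExp_left {N : ℕ} (z : Fin N → ℂ) :
    Continuous fun a : Fin N → ℝ => sphExp a z := by
  refine continuous_sph (A := fun a : Fin N → ℝ => diagonal fun i => (Real.exp (a i) : ℂ))
    ?_ continuous_const fun a => posDef_diagonal_ofReal fun i => Real.exp_pos _
  refine Continuous.matrix_diagonal (continuous_pi fun i => ?_)
  exact Complex.continuous_ofReal.comp (Real.continuous_exp.comp (continuous_apply i))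

/-- The spherical function is jointly continuous and agrees with the quotient on a dense set, so it
is the extension by continuity. -/
theorem normalizedBessel_eq_sphExp {N : ℕ} (a : Fin N → ℝ) (z : Fin N → ℂ) :
    normalizedBessel a z = sphExp a z := by
  have hdense : Dense {p : (Fin N → ℝ) × (Fin N → ℂ) |
      Function.Injective p.1 ∧ Function.Injective p.2} :=
    (dense_setOf_injective ℝ).prod (dense_setOf_injective ℂ)
  refine extendFrom_eq (hdense (a, z)) ?_
  have h := (continuous_sphExp.tendsto (a, z)).mono_left
    (nhdsWithin_le_nhds (s := {p : (Fin N → ℝ) × (Fin N → ℂ) |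
      Function.Injective p.1 ∧ Function.Injective p.2}))
  refine h.congr' ?_
  filter_upwards [self_mem_nhdsWithin] with p hp
  exact sph_diagonal_exp hp.1 hp.2

theorem eigenvalues_congr {E : Type*} [NormedAddCommGroup E] [InnerProductSpace ℂ E]
    [FiniteDimensional ℂ E] {m : ℕ} {S T : E →ₗ[ℂ] E} (h : S = T) (hS : S.IsSymmetric)
    (hT : T.IsSymmetric) (hm : Module.finrank ℂ E = m) (i : Fin m) :
    hS.eigenvalues hm i = hT.eigenvalues hm i := by
  subst h; rfl

theorem exists_sqSingularValues_eq {N : ℕ} (A : Matrix (Fin N) (Fin N) ℂ)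
    (hA : (Aᴴ * A).IsHermitian) :
    ∃ e : Fin N ≃ Fin N, ∀ j, sqSingularValues A j = hA.eigenvalues (e j) := by
  refine ⟨(finCongr (Fintype.card_fin N).symm).trans
    (Fintype.equivOfCardEq (Fintype.card_fin _)), fun j => ?_⟩
  rw [IsHermitian.eigenvalues, Equiv.trans_apply, Equiv.symm_apply_apply]
  rw [IsHermitian.eigenvalues₀]
  have h := (Matrix.toEuclideanLin A).sq_singularValues_fin
    (finrank_euclideanSpace (𝕜 := ℂ) (ι := Fin N)) (finCongr (Fintype.card_fin N).symm j)
  have h2 : ((Matrix.toEuclideanLin A).singularValues (j : ℕ)) ^ 2 = _ := h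
  rw [sqSingularValues, h2]
  refine eigenvalues_congr ?_ _ _ _ _
  rw [← Matrix.toEuclideanLin_conjTranspose_eq_adjoint]
  ext v i
  simp [Matrix.toLpLin_apply]

theorem sqSingularValues_pos {N : ℕ} {A : Matrix (Fin N) (Fin N) ℂ} (hA : IsUnit A) (j : Fin N) :
    0 < sqSingularValues A j := by
  obtain ⟨e, he⟩ := exists_sqSingularValues_eq A (posDef_gram hA).isHermitian
  rw [he]
  exact (posDef_gram hA).eigenvalues_pos _

theorem sph_gram_eq_sphExp {N : ℕ} {A : Matrix (Fin N) (Fin N) ℂ} (hA : IsUnit A)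
    (z : Fin N → ℂ) :
    sph (Aᴴ * A) z = sphExp (fun j => Real.log (sqSingularValues A j)) z := by
  have hH := (posDef_gram hA).isHermitian
  obtain ⟨e, he⟩ := exists_sqSingularValues_eq A hH
  rw [sphExp]
  refine sph_eq_of_charpoly_eq hH (isHermitian_diagonal_ofReal _) ?_ z
  rw [charpoly_diagonal, hH.charpoly_eq]
  rw [← Equiv.prod_comp e]
  refine Finset.prod_congr rfl fun j _ => ?_
  rw [Real.exp_log (sqSingularValues_pos hA j), he]
  rfl

theorem besselOfMatrix_eq_sph {N : ℕ} {A : Matrix (Fin N) (Fin N) ℂ} (hA : IsUnit A)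
    (z : Fin N → ℂ) : besselOfMatrix z A = sph (Aᴴ * A) z := by
  rw [besselOfMatrix, normalizedBessel_eq_sphExp, sph_gram_eq_sphExp hA]

/-! ### The eigenrelation of the difference operator -/

/-- The coefficients of the difference operator. -/
def diffCoef {N : ℕ} (c : ℂ) (z : Fin N → ℂ) (i : Fin N) : ℂ :=
  ∏ j ∈ Finset.univ.erase i, (c + z i - z j) / (z i - z j)

theorem prod_erase_eq_prod_succAbove {n : ℕ} (i : Fin (n + 1)) (f : Fin (n + 1) → ℂ) :
    ∏ j ∈ Finset.univ.erase i, f j = ∏ j : Fin n, f (i.succAbove j) := by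
  rw [Fin.univ_succAbove n i, Finset.erase_cons, Finset.prod_map]
  rfl

theorem vandermonde_update {n : ℕ} (z : Fin (n + 1) → ℂ) (i : Fin (n + 1)) (t : ℂ) :
    vandermonde (Function.update z i t) = Equiv.Perm.sign i.cycleRange.symm *
      ((∏ j : Fin n, (t - z (i.succAbove j))) *
        vandermonde fun j => z (i.succAbove j)) := by
  have h := vandermonde_comp_perm (Function.update z i t) i.cycleRange.symm
  have hs : ((Equiv.Perm.sign i.cycleRange.symm : ℤ) : ℂ) *
      ((Equiv.Perm.sign i.cycleRange.symm : ℤ) : ℂ) = 1 := by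
    rcases Int.units_eq_one_or (Equiv.Perm.sign i.cycleRange.symm) with h | h <;> simp only [h] <;>
      simp
  have h2 : vandermonde (Function.update z i t ∘ i.cycleRange.symm) =
      (∏ j : Fin n, (t - z (i.succAbove j))) * vandermonde fun j => z (i.succAbove j) := by
    rw [vandermonde, vandermonde, Fin.prod_univ_succ]
    simp [Fin.prod_Ioi_succ, Fin.cycleRange_symm_succ]
  rw [← h2, h, ← mul_assoc, hs, one_mul]

/-- Shifting `z_i` alters only the factors that involve `z_i`, and the coefficient is exactly the
quotient of the two Vandermonde products. Hence `𝓓_c` is the sum of shifts conjugated by `Δ`. -/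
theorem diffCoef_mul_vandermonde {N : ℕ} (c : ℂ) {z : Fin N → ℂ} (hz : Function.Injective z)
    (i : Fin N) : diffCoef c z i * vandermonde z = vandermonde (Function.update z i (z i + c)) := by
  obtain _ | n := N
  · exact i.elim0
  have h1 := vandermonde_update z i (z i)
  rw [Function.update_eq_self] at h1
  rw [h1, vandermonde_update, diffCoef, prod_erase_eq_prod_succAbove, mul_left_comm, ← mul_assoc
    (∏ j : Fin n, _), ← Finset.prod_mul_distrib]
  congr 2
  refine Finset.prod_congr rfl fun j _ => ?_
  rw [div_mul_cancel₀ _ (sub_ne_zero.2 (hz.ne (Fin.succAbove_ne i j).symm))]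
  ring

/-- Expand each determinant along its altered row. For fixed `j` the sum over `i` is the cofactor
expansion of `det M` along column `j`. -/
theorem sum_det_updateRow {N : ℕ} (M : Matrix (Fin N) (Fin N) ℂ) (d : Fin N → ℂ) :
    ∑ i, (M.updateRow i fun j => M i j * d j).det = (∑ j, d j) * M.det := by
  have h : ∀ i, (M.updateRow i fun j => M i j * d j).det =
      ∑ j, d j * (M.adjugate j i * M i j) := by
    intro i
    rw [← cramer_transpose_apply, cramer_eq_adjugate_mulVec, ← adjugate_transpose]
    simp only [mulVec, dotProduct, transpose_apply]
    exact Finset.sum_congr rfl fun j _ => by ring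
  simp only [h]
  rw [Finset.sum_comm, Finset.sum_mul]
  refine Finset.sum_congr rfl fun j _ => ?_
  rw [← Finset.mul_sum, ← mul_apply, adjugate_mul]
  simp

theorem sum_expDet_update {N : ℕ} (c : ℂ) (a : Fin N → ℝ) (z : Fin N → ℂ) :
    ∑ i, expDet a (Function.update z i (z i + c)) =
      (∑ j, Complex.exp (c * (a j : ℂ))) * expDet a z := by
  rw [expDet, ← sum_det_updateRow]
  refine Finset.sum_congr rfl fun i _ => ?_
  rw [expDet]
  congr 1
  ext k j
  rcases eq_or_ne k i with rfl | hk
  · simp [← Complex.exp_add, add_mul]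
  · simp [hk]

theorem expDet_eq_zero {N : ℕ} (a : Fin N → ℝ) {z : Fin N → ℂ} (hz : ¬ Function.Injective z) :
    expDet a z = 0 := by
  simp only [Function.Injective, not_forall] at hz
  obtain ⟨i, j, hij, hne⟩ := hz
  exact det_zero_of_row_eq hne (by ext k; simp [hij])

theorem sum_diffCoef_mul_sphExp {N : ℕ} (c : ℂ) (a : Fin N → ℝ) {z : Fin N → ℂ}
    (hz : Function.Injective z) :
    ∑ i, diffCoef c z i * sphExp a (Function.update z i (z i + c)) =
      (∑ j, Complex.exp (c * (a j : ℂ))) * sphExp a z := by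
  have hd : Dense {a : Fin N → ℝ | Function.Injective a} := dense_setOf_injective ℝ
  have h1 : Continuous fun a : Fin N → ℝ =>
      ∑ i, diffCoef c z i * sphExp a (Function.update z i (z i + c)) :=
    continuous_finsetSum _ fun i _ => continuous_const.mul (continuous_sphExp_left _)
  have h2 : Continuous fun a : Fin N → ℝ =>
      (∑ j, Complex.exp (c * (a j : ℂ))) * sphExp a z :=
    Continuous.mul (by fun_prop) (continuous_sphExp_left z)
  suffices h : Set.EqOn (fun a : Fin N → ℝ =>
      ∑ i, diffCoef c z i * sphExp a (Function.update z i (z i + c)))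
      (fun a => (∑ j, Complex.exp (c * (a j : ℂ))) * sphExp a z)
      {a : Fin N → ℝ | Function.Injective a} from
    congrFun (Continuous.ext_on hd h1 h2 h) a
  clear a
  intro a ha
  beta_reduce
  have hV := (vandermonde_ne_zero_iff z).2 hz
  have key : ∀ i, diffCoef c z i * sphExp a (Function.update z i (z i + c)) =
      expDet a (Function.update z i (z i + c)) / vandermonde z / multivariateBessel a (rho N) := by
    intro i
    have h := diffCoef_mul_vandermonde c hz i
    -- The shift may make two coordinates collide, where the determinantal formula is unavailable;
    -- then the coefficient and the determinant both vanish.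
    by_cases hi : Function.Injective (Function.update z i (z i + c))
    · have hV' := (vandermonde_ne_zero_iff _).2 hi
      rw [sphExp, sph_diagonal_exp ha hi, multivariateBessel_eq, ← h]
      rw [← h] at hV'
      have hcf := left_ne_zero_of_mul hV'
      field_simp
    · have h0 : diffCoef c z i = 0 := by
        have : vandermonde (Function.update z i (z i + c)) = 0 := by
          by_contra hne; exact hi ((vandermonde_ne_zero_iff _).1 hne)
        rw [this] at h
        exact (mul_eq_zero.1 h).resolve_right hV
      rw [h0, expDet_eq_zero a hi]
      simp
  simp only [key]
  rw [← Finset.sum_div, ← Finset.sum_div, sum_expDet_update, sphExp, sph_diagonal_exp ha hz,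
    multivariateBessel_eq a z]
  ring

theorem sum_diffCoef_mul_sph {N : ℕ} (c : ℝ) {A : Matrix (Fin N) (Fin N) ℂ} (hA : IsUnit A)
    {z : Fin N → ℂ} (hz : Function.Injective z) :
    ∑ i, diffCoef c z i * sph (Aᴴ * A) (Function.update z i (z i + c)) =
      ((∑ j, sqSingularValues A j ^ c : ℝ) : ℂ) * sph (Aᴴ * A) z := by
  simp only [sph_gram_eq_sphExp hA]
  rw [sum_diffCoef_mul_sphExp c _ hz]
  congr 1
  push_cast
  refine Finset.sum_congr rfl fun j _ => ?_
  rw [Real.rpow_def_of_pos (sqSingularValues_pos hA j)]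
  push_cast
  rw [mul_comm]

/-- `ρ_N` is the reversal of `revRho`, and Bessel functions are symmetric in `z`; repeated singular
values are reached by density. -/
theorem sph_rho {N : ℕ} {A : Matrix (Fin N) (Fin N) ℂ} (hA : IsUnit A) :
    sph (Aᴴ * A) (rho N) = 1 := by
  have hd : Dense {a : Fin N → ℝ | Function.Injective a} := dense_setOf_injective ℝ
  have h : (fun a : Fin N → ℝ => sphExp a (rho N)) = fun a => sphExp a (revRho N) := by
    refine Continuous.ext_on hd (continuous_sphExp_left _) (continuous_sphExp_left _)
      fun a ha => ?_
    rw [sphExp, sphExp]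
    rw [sph_diagonal_exp ha (rho_injective N), sph_diagonal_exp ha (revRho_injective N),
      multivariateBessel_rho]
  rw [sph_gram_eq_sphExp hA, congrFun h (fun j => Real.log (sqSingularValues A j)), sphExp, sph_revRho]

end RMP

end

noncomputable section

namespace RMP
open Matrix Filter Topology
open scoped ComplexOrder

/-! ### Spherical functions of products of random matrices -/

/-- The spherical function of the squared singular values of a matrix. -/
def gramSph {N : ℕ} (z : Fin N → ℂ) (A : Matrix (Fin N) (Fin N) ℂ) : ℂ := sph (Aᴴ * A) z

theorem measurable_gramSph {N : ℕ} (z : Fin N → ℂ) : Measurable (gramSph z) := by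
  have h : Continuous fun A : Matrix (Fin N) (Fin N) ℂ => Aᴴ * A := by fun_prop
  exact (stronglyMeasurable_sph z).measurable.comp h.measurable

theorem continuous_gramSph_unitary {N : ℕ} (z : Fin N → ℂ) {x y : Matrix (Fin N) (Fin N) ℂ}
    (hx : IsUnit x) (hy : IsUnit y) :
    Continuous fun k : unitaryGroup (Fin N) ℂ => gramSph z (x * k.1 * y) := by
  have hk : Continuous fun k : unitaryGroup (Fin N) ℂ => x * k.1 * y := by fun_prop
  refine continuous_sph (z := fun _ => z) ?_ continuous_const fun k =>
    posDef_gram ((hx.mul (isUnit_unitary k)).mul hy)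
  exact hk.matrix_conjTranspose.matrix_mul hk

theorem lintegral_gramSph_mul {N : ℕ} (r : Fin N → ℝ) {x y : Matrix (Fin N) (Fin N) ℂ}
    (hx : IsUnit x) (hy : IsUnit y) :
    ∫⁻ k : unitaryGroup (Fin N) ℂ, ‖gramSph (fun i => (r i : ℂ)) (x * k.1 * y)‖ₑ ∂haarU N =
      ‖gramSph (fun i => (r i : ℂ)) x‖ₑ * ‖gramSph (fun i => (r i : ℂ)) y‖ₑ := by
  have hint := integrable_of_continuous_haarU
    (continuous_gramSph_unitary (fun i => (r i : ℂ)) hx hy)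
  have h : ∫ k : unitaryGroup (Fin N) ℂ, gramSph (fun i => (r i : ℂ)) (x * k.1 * y) ∂haarU N =
      gramSph (fun i => (r i : ℂ)) x * gramSph (fun i => (r i : ℂ)) y :=
    integral_sph_mul hx hy _
  have h2 : ∫ k : unitaryGroup (Fin N) ℂ, gramSph (fun i => (r i : ℂ)) (x * k.1 * y) ∂haarU N =
      ((∫ k : unitaryGroup (Fin N) ℂ, ‖gramSph (fun i => (r i : ℂ)) (x * k.1 * y)‖ ∂haarU N : ℝ)
        : ℂ) := by
    rw [← integral_complex_ofReal]
    exact integral_congr_ae (Eventually.of_forall fun k => sph_ofReal _ r)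
  rw [← enorm_mul, ← h, h2, ← ofReal_integral_norm_eq_lintegral_enorm hint, ← ofReal_norm,
    Complex.norm_real, Real.norm_of_nonneg (integral_nonneg fun _ => norm_nonneg _)]

/-- Averaging over the unitary group does not change a right invariant measure. -/
theorem measurePreserving_mul_unitary {N : ℕ} {E : Type*} [MeasurableSpace E]
    (μ : Measure (Matrix (Fin N) (Fin N) ℂ)) [SFinite μ] (ν : Measure E) [SFinite ν]
    (hμ : ∀ k : unitaryGroup (Fin N) ℂ, μ.map (fun x => x * k.1) = μ) :
    MeasurePreserving (fun p : (Matrix (Fin N) (Fin N) ℂ × E) × unitaryGroup (Fin N) ℂ =>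
      (p.1.1 * p.2.1, p.1.2)) ((μ.prod ν).prod (haarU N)) (μ.prod ν) := by
  have hm : Measurable fun p : (Matrix (Fin N) (Fin N) ℂ × E) × unitaryGroup (Fin N) ℂ =>
      (p.1.1 * p.2.1, p.1.2) := by
    have h : Continuous fun p : Matrix (Fin N) (Fin N) ℂ × unitaryGroup (Fin N) ℂ =>
      p.1 * p.2.1 := by fun_prop
    exact (h.measurable.comp ((measurable_fst.comp measurable_fst).prodMk measurable_snd)).prodMk
      (measurable_snd.comp measurable_fst)
  refine ⟨hm, Measure.ext fun s hs => ?_⟩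
  rw [Measure.map_apply hm hs, Measure.prod_apply_symm (hm hs)]
  have h : ∀ k : unitaryGroup (Fin N) ℂ, (μ.prod ν) ((fun p => (p, k)) ⁻¹'
      ((fun p : (Matrix (Fin N) (Fin N) ℂ × E) × unitaryGroup (Fin N) ℂ =>
        (p.1.1 * p.2.1, p.1.2)) ⁻¹' s)) = (μ.prod ν) s := by
    intro k
    have hk : MeasurePreserving (fun x : Matrix (Fin N) (Fin N) ℂ => x * k.1) μ μ :=
      ⟨(continuous_id.matrix_mul continuous_const).measurable, hμ k⟩
    exact (hk.prod (MeasurePreserving.id ν)).measure_preimage hs.nullMeasurableSet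
  simp [h]

/-- Right invariance of `μ` lets a Haar unitary be inserted between the two factors, and the
functional equation then splits the spherical function. The complex coordinate of `ν` carries a
weight that may depend on the second factor. -/
theorem integrable_gramSph_mul {N : ℕ} {μ : Measure (Matrix (Fin N) (Fin N) ℂ)} [SFinite μ]
    {ν : Measure (ℂ × Matrix (Fin N) (Fin N) ℂ)} [SFinite ν]
    (hμ : ∀ k : unitaryGroup (Fin N) ℂ, μ.map (fun x => x * k.1) = μ)
    (hμu : ∀ᵐ x ∂μ, IsUnit x) (hνu : ∀ᵐ w ∂ν, IsUnit w.2)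
    (hμi : ∀ z, Integrable (gramSph z) μ) (hνi : ∀ z, Integrable (fun w => w.1 * gramSph z w.2) ν)
    (z : Fin N → ℂ) :
    Integrable (fun p : Matrix (Fin N) (Fin N) ℂ × (ℂ × Matrix (Fin N) (Fin N) ℂ) =>
      p.2.1 * gramSph z (p.1 * p.2.2)) (μ.prod ν) ∧
    ∫ p, p.2.1 * gramSph z (p.1 * p.2.2) ∂μ.prod ν =
      (∫ x, gramSph z x ∂μ) * ∫ w, w.1 * gramSph z w.2 ∂ν := by
  have hmul : Measurable fun p : Matrix (Fin N) (Fin N) ℂ × (ℂ × Matrix (Fin N) (Fin N) ℂ) =>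
      p.1 * p.2.2 := by
    have h : Continuous fun p : Matrix (Fin N) (Fin N) ℂ × (ℂ × Matrix (Fin N) (Fin N) ℂ) =>
      p.1 * p.2.2 := by fun_prop
    exact h.measurable
  have hmeas : ∀ z, Measurable fun p : Matrix (Fin N) (Fin N) ℂ ×
      (ℂ × Matrix (Fin N) (Fin N) ℂ) => p.2.1 * gramSph z (p.1 * p.2.2) := fun z =>
    (measurable_fst.comp measurable_snd).mul ((measurable_gramSph z).comp hmul)
  have hu : ∀ᵐ p ∂μ.prod ν, IsUnit p.1 ∧ IsUnit p.2.2 :=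
    (Measure.quasiMeasurePreserving_fst.ae hμu).and (Measure.quasiMeasurePreserving_snd.ae hνu)
  have hT := measurePreserving_mul_unitary μ ν hμ
  have hint : Integrable (fun p : Matrix (Fin N) (Fin N) ℂ × (ℂ × Matrix (Fin N) (Fin N) ℂ) =>
      p.2.1 * gramSph z (p.1 * p.2.2)) (μ.prod ν) := by
    refine ⟨(hmeas z).aestronglyMeasurable, ?_⟩
    set r : Fin N → ℝ := fun i => (z i).re
    -- Passing to the real part of the parameter makes the spherical function positive, so that the
    -- functional equation computes the integral of the norm by Tonelli.
    calc ∫⁻ p, ‖p.2.1 * gramSph z (p.1 * p.2.2)‖ₑ ∂μ.prod ν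
        ≤ ∫⁻ p, ‖p.2.1 * gramSph (fun i => (r i : ℂ)) (p.1 * p.2.2)‖ₑ ∂μ.prod ν := by
          refine lintegral_mono fun p => ?_
          rw [enorm_mul, enorm_mul]
          gcongr
          exact enorm_le_iff_norm_le.2 (norm_sph_le _ z)
      _ = ∫⁻ q, ‖q.1.2.1 * gramSph (fun i => (r i : ℂ)) (q.1.1 * q.2.1 * q.1.2.2)‖ₑ
            ∂(μ.prod ν).prod (haarU N) :=
          (hT.lintegral_comp (hmeas _).enorm).symm
      _ = ∫⁻ p, ∫⁻ k : unitaryGroup (Fin N) ℂ,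
            ‖p.2.1 * gramSph (fun i => (r i : ℂ)) (p.1 * k.1 * p.2.2)‖ₑ ∂haarU N ∂μ.prod ν :=
          lintegral_prod _ ((hmeas _).enorm.comp hT.measurable).aemeasurable
      _ = ∫⁻ p, ‖gramSph (fun i => (r i : ℂ)) p.1 *
            (p.2.1 * gramSph (fun i => (r i : ℂ)) p.2.2)‖ₑ ∂μ.prod ν := by
          refine lintegral_congr_ae ?_
          filter_upwards [hu] with p hp
          simp only [enorm_mul]
          rw [lintegral_const_mul' _ _ enorm_ne_top, lintegral_gramSph_mul r hp.1 hp.2]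
          ring
      _ < ⊤ := ((hμi _).mul_prod (hνi _)).2
  refine ⟨hint, ?_⟩
  rw [← integral_prod_mul, ← hT.map_eq, integral_map hT.measurable.aemeasurable
    (hmeas z).aestronglyMeasurable, hT.map_eq]
  refine (integral_prod _ (hT.integrable_comp_of_integrable hint)).trans ?_
  refine integral_congr_ae ?_
  filter_upwards [hu] with p hp
  have h : ∫ k : unitaryGroup (Fin N) ℂ, gramSph z (p.1 * k.1 * p.2.2) ∂haarU N =
      gramSph z p.1 * gramSph z p.2.2 := integral_sph_mul hp.1 hp.2 z
  simp only [Function.comp_apply]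
  rw [integral_const_mul, h]
  ring

end RMP

end

noncomputable section

namespace RMP
open Matrix Filter Topology
open scoped ComplexOrder

/-! ### Moments of products of random matrices -/

section Moments

variable {Ω : Type*} {N : ℕ} {X : ℕ → Ω → Matrix (Fin N) (Fin N) ℂ}

/-- The sigma-algebra generated by `X 1, …, X m`. -/
abbrev past (X : ℕ → Ω → Matrix (Fin N) (Fin N) ℂ) (m : ℕ) : MeasurableSpace Ω :=
  ⨆ j ∈ {j : {j : ℕ // 1 ≤ j} | (j : ℕ) ≤ m}, MeasurableSpace.comap (X j) inferInstance

theorem past_mono {m m' : ℕ} (h : m ≤ m') : past X m ≤ past X m' :=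
  biSup_mono fun _ hj => le_trans hj h

theorem measurable_past {m : ℕ} (hm : 1 ≤ m) : Measurable[past X m] (X m) := by
  refine Measurable.of_comap_le ?_
  exact le_biSup (fun j : {j : ℕ // 1 ≤ j} => MeasurableSpace.comap (X j) inferInstance)
    (show (⟨m, hm⟩ : {j : ℕ // 1 ≤ j}) ∈ {j : {j : ℕ // 1 ≤ j} | (j : ℕ) ≤ m} from le_refl m)

theorem measurable_matProd_past : ∀ m : ℕ,
    Measurable[past X m] fun ω => matProd (fun m => X m ω) m
  | 0 => measurable_const
  | m + 1 => by
    have h : Continuous fun p : Matrix (Fin N) (Fin N) ℂ × Matrix (Fin N) (Fin N) ℂ =>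
      p.1 * p.2 := by fun_prop
    exact h.measurable.comp ((measurable_past (Nat.le_add_left 1 m)).prodMk
      ((measurable_matProd_past m).mono (past_mono (Nat.le_succ m)) le_rfl))

variable [mΩ : MeasurableSpace Ω] {P : Measure Ω}

theorem past_le (hmeas : ∀ m, 1 ≤ m → Measurable (X m)) (m : ℕ) : past X m ≤ mΩ :=
  iSup₂_le fun j _ => (hmeas j j.2).comap_le

theorem ae_isUnit_matProd (hnonsing : ∀ m, 1 ≤ m → ∀ᵐ ω ∂P, IsUnit (X m ω)) : ∀ m : ℕ,
    ∀ᵐ ω ∂P, IsUnit (matProd (fun m => X m ω) m)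
  | 0 => Eventually.of_forall fun _ => isUnit_one
  | m + 1 => by
    filter_upwards [hnonsing (m + 1) (Nat.le_add_left 1 m), ae_isUnit_matProd hnonsing m]
      with ω h1 h2 using h1.mul h2

theorem indepFun_past {E : Type*} [MeasurableSpace E] {W : Ω → E}
    (hmeas : ∀ m, 1 ≤ m → Measurable (X m))
    (hindep : iIndepFun (fun m : {m : ℕ // 1 ≤ m} => X m) P) {m : ℕ}
    (hW : Measurable[past X m] W) : IndepFun (X (m + 1)) W P := by
  have hdisj : Disjoint {(⟨m + 1, Nat.le_add_left 1 m⟩ : {j : ℕ // 1 ≤ j})}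
      {j : {j : ℕ // 1 ≤ j} | (j : ℕ) ≤ m} := by
    rw [Set.disjoint_singleton_left]
    exact fun h => absurd (show m + 1 ≤ m from h) (by omega)
  have h := indep_iSup_of_disjoint (fun j : {j : ℕ // 1 ≤ j} => (hmeas j j.2).comap_le)
    ((iIndepFun_iff_iIndep _ _ _).1 hindep) hdisj
  rw [iSup_singleton] at h
  exact (IndepFun_iff_Indep _ _ _).2 (indep_of_indep_of_le_right h hW.comap_le)

/-- `F z` is the expectation of `H` times the spherical function of `X m ⋯ X 1`. -/
structure IsMoment (P : Measure Ω) (X : ℕ → Ω → Matrix (Fin N) (Fin N) ℂ) (m : ℕ) (H : Ω → ℂ)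
    (F : (Fin N → ℂ) → ℂ) : Prop where
  meas : Measurable[past X m] H
  integrable : ∀ z, Integrable (fun ω => H ω * gramSph z (matProd (fun m => X m ω) m)) P
  integral_eq : ∀ z, ∫ ω, H ω * gramSph z (matProd (fun m => X m ω) m) ∂P = F z

theorem isMoment_zero [IsProbabilityMeasure P] : IsMoment P X 0 1 1 where
  meas := measurable_const
  integrable z := by simp [matProd, gramSph, sph_one]
  integral_eq z := by simp [matProd, gramSph, sph_one]

/-- The new factor is independent of the weight and the earlier product jointly, so their law is a
product measure and the split average applies. -/
theorem IsMoment.succ [IsProbabilityMeasure P]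
    (hmeas : ∀ m, 1 ≤ m → Measurable (X m))
    (hindep : iIndepFun (fun m : {m : ℕ // 1 ≤ m} => X m) P)
    (hnonsing : ∀ m, 1 ≤ m → ∀ᵐ ω ∂P, IsUnit (X m ω))
    (hinv : ∀ m, 1 ≤ m → RightUnitarilyInvariant P (X m))
    (hexists : ∀ m, 1 ≤ m → ∀ z : Fin N → ℂ, Integrable (fun ω => besselOfMatrix z (X m ω)) P)
    {m : ℕ} {H : Ω → ℂ} {F : (Fin N → ℂ) → ℂ} (h : IsMoment P X m H F) :
    IsMoment P X (m + 1) H (besselGenFun P (X (m + 1)) * F) := by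
  have hX := hmeas (m + 1) (Nat.le_add_left 1 m)
  have hXu := hnonsing (m + 1) (Nat.le_add_left 1 m)
  have hWp : Measurable[past X m] fun ω => (H ω, matProd (fun m => X m ω) m) :=
    h.meas.prodMk (measurable_matProd_past m)
  have hW := hWp.mono (past_le hmeas m) le_rfl
  have hXW := (indepFun_past hmeas hindep hWp)
  have hprod := (indepFun_iff_map_prod_eq_prod_map_map hX.aemeasurable hW.aemeasurable).1 hXW
  have : IsProbabilityMeasure (P.map (X (m + 1))) :=
    Measure.isProbabilityMeasure_map hX.aemeasurable
  have : IsProbabilityMeasure (P.map fun ω => (H ω, matProd (fun m => X m ω) m)) :=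
    Measure.isProbabilityMeasure_map hW.aemeasurable
  have hμ : ∀ k : unitaryGroup (Fin N) ℂ,
      (P.map (X (m + 1))).map (fun x => x * k.1) = P.map (X (m + 1)) := fun k => by
    have hk : Continuous fun x : Matrix (Fin N) (Fin N) ℂ => x * k.1 := by fun_prop
    rw [Measure.map_map hk.measurable hX]
    exact hinv (m + 1) (Nat.le_add_left 1 m) k.1 k.2
  have hunit : MeasurableSet {x : Matrix (Fin N) (Fin N) ℂ | IsUnit x} := by
    simp only [isUnit_iff_isUnit_det, isUnit_iff_ne_zero]
    have hdet : Continuous fun x : Matrix (Fin N) (Fin N) ℂ => x.det := by fun_prop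
    exact (hdet.measurable (measurableSet_singleton 0)).compl
  have hμu : ∀ᵐ x ∂P.map (X (m + 1)), IsUnit x := (ae_map_iff hX.aemeasurable hunit).2 hXu
  have hνu : ∀ᵐ w ∂P.map (fun ω => (H ω, matProd (fun m => X m ω) m)), IsUnit w.2 :=
    (ae_map_iff hW.aemeasurable (measurable_snd hunit)).2 (ae_isUnit_matProd hnonsing m)
  have hbes : ∀ z, (fun ω => besselOfMatrix z (X (m + 1) ω)) =ᵐ[P]
      fun ω => gramSph z (X (m + 1) ω) := fun z => by
    filter_upwards [hXu] with ω hω using besselOfMatrix_eq_sph hω z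
  have hμi : ∀ z, Integrable (gramSph z) (P.map (X (m + 1))) := fun z =>
    (integrable_map_measure (measurable_gramSph z).aestronglyMeasurable hX.aemeasurable).2
      ((hexists (m + 1) (Nat.le_add_left 1 m) z).congr (hbes z))
  have hgm : ∀ z : Fin N → ℂ, Measurable fun w : ℂ × Matrix (Fin N) (Fin N) ℂ =>
      w.1 * gramSph z w.2 := fun z =>
    measurable_fst.mul ((measurable_gramSph z).comp measurable_snd)
  have hνi : ∀ z, Integrable (fun w : ℂ × Matrix (Fin N) (Fin N) ℂ => w.1 * gramSph z w.2)
      (P.map fun ω => (H ω, matProd (fun m => X m ω) m)) := fun z =>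
    (integrable_map_measure (hgm z).aestronglyMeasurable hW.aemeasurable).2 (h.integrable z)
  have key := integrable_gramSph_mul hμ hμu hνu hμi hνi
  have hXWm : Measurable fun ω => (X (m + 1) ω, (H ω, matProd (fun m => X m ω) m)) :=
    hX.prodMk hW
  rw [← hprod] at key
  refine ⟨h.meas.mono (past_mono (Nat.le_succ m)) le_rfl, fun z => ?_, fun z => ?_⟩
  · exact (key z).1.comp_measurable hXWm
  · have h1 := (key z).2
    rw [integral_map hXWm.aemeasurable (key z).1.aestronglyMeasurable,
      integral_map hX.aemeasurable (measurable_gramSph z).aestronglyMeasurable,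
      integral_map hW.aemeasurable (hgm z).aestronglyMeasurable, h.integral_eq] at h1
    refine h1.trans ?_
    rw [Pi.mul_apply, besselGenFun, integral_congr_ae (hbes z)]

theorem IsMoment.of_le [IsProbabilityMeasure P]
    (hmeas : ∀ m, 1 ≤ m → Measurable (X m))
    (hindep : iIndepFun (fun m : {m : ℕ // 1 ≤ m} => X m) P)
    (hnonsing : ∀ m, 1 ≤ m → ∀ᵐ ω ∂P, IsUnit (X m ω))
    (hinv : ∀ m, 1 ≤ m → RightUnitarilyInvariant P (X m))
    (hexists : ∀ m, 1 ≤ m → ∀ z : Fin N → ℂ, Integrable (fun ω => besselOfMatrix z (X m ω)) P)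
    {m m' : ℕ} (hm : m ≤ m') {H : Ω → ℂ} {F : (Fin N → ℂ) → ℂ} (h : IsMoment P X m H F) :
    IsMoment P X m' H ((fun z => ∏ j ∈ Finset.Ioc m m', besselGenFun P (X j) z) * F) := by
  induction m', hm using Nat.le_induction with
  | base =>
    convert h using 1
    ext z
    simp
  | succ m' hm ih =>
    convert ih.succ hmeas hindep hnonsing hinv hexists using 1
    ext z
    simp only [Pi.mul_apply]
    rw [Finset.prod_Ioc_succ_top hm]
    ring

/-- The power sum `∑ x_j ^ c` of the squared singular values, as a combination of spherical
functions. -/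
def powerSum {N : ℕ} (c : ℂ) (A : Matrix (Fin N) (Fin N) ℂ) : ℂ :=
  ∑ i, diffCoef c (rho N) i * gramSph (Function.update (rho N) i (rho N i + c)) A

theorem measurable_powerSum (c : ℂ) :
    Measurable (powerSum c : Matrix (Fin N) (Fin N) ℂ → ℂ) :=
  Finset.measurable_fun_sum _ fun _ _ => (measurable_gramSph _).const_mul _

/-- This is the eigenrelation at `ρ_N`, where the spherical function is 1. It gives the power sum a
form whose measurability is immediate. -/
theorem powerSum_eq (c : ℝ) {A : Matrix (Fin N) (Fin N) ℂ} (hA : IsUnit A) :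
    powerSum c A = ((∑ j, sqSingularValues A j ^ c : ℝ) : ℂ) := by
  have h := sum_diffCoef_mul_sph c hA (rho_injective N)
  rw [sph_rho hA, mul_one] at h
  exact h

/-- For fixed signs the offsets `±(i + 1)` are distinct, so only finitely many `s` are bad for any
of the vertices. Taking `s > 1` puts the unit neighbourhood of `r` inside the box. -/
theorem exists_injective_box (r : Fin N → ℝ) : ∃ s : ℝ, 1 < s ∧ ∀ v : Fin N → Bool,
    Function.Injective fun i => if v i then r i - s * ((i : ℕ) + 1) else r i + s * ((i : ℕ) + 1) := by
  have hfin : (⋃ v : Fin N → Bool, {s : ℝ | ¬ Function.Injective fun i =>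
      r i + s * (if v i then -(((i : ℕ) : ℝ) + 1) else ((i : ℕ) : ℝ) + 1)}).Finite := by
    refine Set.finite_iUnion fun v => finite_setOf_not_injective r fun i j hij => ?_
    have hi : (0 : ℝ) ≤ (i : ℕ) := Nat.cast_nonneg _
    have hj : (0 : ℝ) ≤ (j : ℕ) := Nat.cast_nonneg _
    have : ((i : ℕ) : ℝ) = (j : ℕ) := by
      split_ifs at hij <;> linarith
    exact Fin.ext (by exact_mod_cast this)
  obtain ⟨s, hs, hs'⟩ := (Set.Ioi_infinite (1 : ℝ)).exists_notMem_finite hfin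
  refine ⟨s, hs, fun v => ?_⟩
  simp only [Set.mem_iUnion, Set.mem_ofPred_eq, not_exists, not_not] at hs'
  convert hs' v using 2 with i
  split_ifs <;> ring

/-- At parameters with distinct coordinates, linearity of the expectation and the eigenrelation give
the claim. Elsewhere it follows because the expectation on the weighted side is continuous in `z`,
so it supplies the limit that defines `diffOp`. -/
theorem IsMoment.diffOp (hmeas : ∀ m, 1 ≤ m → Measurable (X m))
    (hnonsing : ∀ m, 1 ≤ m → ∀ᵐ ω ∂P, IsUnit (X m ω)) (c : ℝ)
    {m : ℕ} {H : Ω → ℂ} {F : (Fin N → ℂ) → ℂ} (h : IsMoment P X m H F) :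
    IsMoment P X m (fun ω => H ω * powerSum c (matProd (fun m => X m ω) m)) (diffOp c F) := by
  have hu := ae_isUnit_matProd hnonsing m
  have hYp := measurable_matProd_past (X := X) m
  have hmeasH : Measurable[past X m] fun ω => H ω * powerSum c (matProd (fun m => X m ω) m) :=
    h.meas.mul ((measurable_powerSum c).comp hYp)
  set G : (Fin N → ℂ) → Ω → ℂ := fun z ω =>
    H ω * powerSum c (matProd (fun m => X m ω) m) * gramSph z (matProd (fun m => X m ω) m)
    with hG
  have hGm : ∀ z, AEStronglyMeasurable (G z) P := fun z =>
    ((hmeasH.mul ((measurable_gramSph z).comp hYp)).mono (past_le hmeas m)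
      le_rfl).aestronglyMeasurable
  have hsum : ∀ z, Function.Injective z → G z =ᵐ[P] fun ω => ∑ i, diffCoef c z i *
      (H ω * gramSph (Function.update z i (z i + c)) (matProd (fun m => X m ω) m)) := by
    intro z hz
    filter_upwards [hu] with ω hω
    have h1 := sum_diffCoef_mul_sph c hω hz
    rw [← powerSum_eq c hω] at h1
    simp only [hG, mul_assoc]
    rw [show powerSum c (matProd (fun m => X m ω) m) * gramSph z (matProd (fun m => X m ω) m) = _
      from h1.symm, Finset.mul_sum]
    exact Finset.sum_congr rfl fun i _ => mul_left_comm _ _ _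
  have hint : ∀ z, Function.Injective z → Integrable (G z) P := fun z hz =>
    (integrable_finsetSum _ fun i _ => (h.integrable _).const_mul _).congr (hsum z hz).symm
  have hformula : ∀ z, Function.Injective z → ∫ ω, G z ω ∂P =
      ∑ i, diffCoef c z i * F (Function.update z i (z i + c)) := by
    intro z hz
    rw [integral_congr_ae (hsum z hz), integral_finsetSum _ fun i _ => (h.integrable _).const_mul _]
    simp only [integral_const_mul, h.integral_eq]
  have hcont : ∀ z, Integrable (G z) P ∧ ContinuousAt (fun w => ∫ ω, G w ω ∂P) z := by
    intro z
    obtain ⟨s, hs, hinj⟩ := exists_injective_box fun i => (z i).re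
    set l : Fin N → ℝ := fun i => (z i).re - s * ((i : ℕ) + 1)
    set u : Fin N → ℝ := fun i => (z i).re + s * ((i : ℕ) + 1)
    set B : Ω → ℝ := fun ω => ∑ v : Fin N → Bool,
      ‖G (fun i => ((if v i then l i else u i : ℝ) : ℂ)) ω‖
    -- The vertices have distinct coordinates, so integrability is already known at each of them.
    have hB : Integrable B P := integrable_finsetSum _ fun v _ =>
      (hint _ (Complex.ofReal_injective.comp (hinj v))).norm
    have hbox : ∀ w : Fin N → ℂ, (∀ i, |(w i).re - (z i).re| < 1) →
        ∀ᵐ ω ∂P, ‖G w ω‖ ≤ B ω := by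
      intro w hw
      filter_upwards [hu] with ω hω
      have hs1 : ∀ i : Fin N, (1 : ℝ) ≤ s * ((i : ℕ) + 1) := fun i => by
        have : (0 : ℝ) ≤ (i : ℕ) := Nat.cast_nonneg _
        nlinarith
      have h1 := norm_sph_le_sum (posDef_gram hω) l u w
        (fun i => by have := abs_lt.1 (hw i); have := hs1 i; simp only [l]; linarith)
        (fun i => by have := abs_lt.1 (hw i); have := hs1 i; simp only [u]; linarith)
      simp only [B, hG, norm_mul]
      rw [← Finset.mul_sum]
      exact mul_le_mul_of_nonneg_left h1 (by positivity)
    refine ⟨hB.mono' (hGm z) (hbox z fun i => by simp), ?_⟩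
    have hnhds : ∀ᶠ w in 𝓝 z, ∀ i, |(w i).re - (z i).re| < 1 := by
      rw [eventually_all]
      intro i
      have hc : Continuous fun w : Fin N → ℂ => |(w i).re - (z i).re| := by fun_prop
      exact hc.continuousAt.eventually_lt_const (by simp)
    refine continuousAt_of_dominated (Eventually.of_forall hGm) (hnhds.mono hbox) hB ?_
    filter_upwards [hu] with ω hω
    have hφ : Continuous fun w : Fin N → ℂ => gramSph w (matProd (fun m => X m ω) m) :=
      continuous_sph continuous_const continuous_id fun _ => posDef_gram hω
    exact (continuous_const.mul hφ).continuousAt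
  refine ⟨hmeasH, fun z => (hcont z).1, fun z => ?_⟩
  refine (extendFrom_eq (dense_setOf_injective ℂ z) ?_).symm
  refine ((hcont z).2.tendsto.mono_left nhdsWithin_le_nhds).congr' ?_
  filter_upwards [self_mem_nhdsWithin] with w hw
  exact hformula w hw

/-- Induction on the number of operators, the innermost belonging to the earliest time. From `M 1`
to `M 0` the new factors contribute their generating functions, and then the outermost operator
inserts the power sum at time `M 0`. The weight `H` agrees with the product of power sums only
almost surely, since it is built from `powerSum`. -/
theorem exists_isMoment_nestedDiffOp [IsProbabilityMeasure P]
    (hmeas : ∀ m, 1 ≤ m → Measurable (X m))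
    (hindep : iIndepFun (fun m : {m : ℕ // 1 ≤ m} => X m) P)
    (hnonsing : ∀ m, 1 ≤ m → ∀ᵐ ω ∂P, IsUnit (X m ω))
    (hinv : ∀ m, 1 ≤ m → RightUnitarilyInvariant P (X m))
    (hexists : ∀ m, 1 ≤ m → ∀ z : Fin N → ℂ, Integrable (fun ω => besselOfMatrix z (X m ω)) P) :
    ∀ (k : ℕ) (c : Fin k → ℝ) (M : Fin (k + 1) → ℕ), Antitone M → M (Fin.last k) = 0 →
    ∃ H : Ω → ℂ, (H =ᵐ[P] fun ω => ((∏ i : Fin k, ∑ j : Fin N,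
        sqSingularValues (matProd (fun m => X m ω) (M i.castSucc)) j ^ c i : ℝ) : ℂ)) ∧
      IsMoment P X (M 0) H (nestedDiffOp k (fun i => (c i : ℂ))
        (fun i z => ∏ m ∈ Finset.Ioc (M i.succ) (M i.castSucc), besselGenFun P (X m) z))
  | 0, c, M, _, hlast => by
    refine ⟨1, by simp; rfl, ?_⟩
    rw [show M 0 = 0 from hlast]
    exact isMoment_zero
  | k + 1, c, M, hM, hlast => by
    obtain ⟨H, hH, hmom⟩ := exists_isMoment_nestedDiffOp hmeas hindep hnonsing hinv hexists k
      (Fin.tail c) (Fin.tail M) (fun i j hij => hM (Fin.succ_le_succ_iff.2 hij)) hlast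
    have h1 : IsMoment P X (M 1) H _ := hmom
    have h2 := (h1.of_le hmeas hindep hnonsing hinv hexists (hM (Fin.zero_le 1))).diffOp
      hmeas hnonsing (c 0)
    refine ⟨_, ?_, h2⟩
    filter_upwards [hH, ae_isUnit_matProd hnonsing (M 0)] with ω hω hu
    rw [hω, powerSum_eq _ hu, Fin.prod_univ_succ, mul_comm, Complex.ofReal_mul]
    rfl

end Moments

end RMP

end

/-! ### The moment formula: evaluation at `ρ_N`. -/

theorem mainTheorem7 {Ω : Type*} [MeasurableSpace Ω] (P : Measure Ω) [IsProbabilityMeasure P]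
    (N : ℕ) (X : ℕ → Ω → Matrix (Fin N) (Fin N) ℂ)
    (hmeas : ∀ m, 1 ≤ m → Measurable (X m))
    (hindep : iIndepFun (fun m : {m : ℕ // 1 ≤ m} => X m) P)
    (hnonsing : ∀ m, 1 ≤ m → ∀ᵐ ω ∂P, IsUnit (X m ω))
    (hinv : ∀ m, 1 ≤ m → RMP.RightUnitarilyInvariant P (X m))
    (hexists : ∀ m, 1 ≤ m → ∀ z : Fin N → ℂ,
      Integrable (fun ω => RMP.besselOfMatrix z (X m ω)) P)
    (hanalytic : ∀ m, 1 ≤ m → AnalyticOnNhd ℂ (RMP.besselGenFun P (X m)) Set.univ)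
    (k : ℕ) (c : Fin k → ℝ) (hc : ∀ i, 0 < c i)
    (M : Fin (k + 1) → ℕ) (hM : Antitone M) (hMpos : ∀ i : Fin k, 0 < M i.castSucc)
    (hMlast : M (Fin.last k) = 0) :
    Integrable (fun ω => ∏ i : Fin k, ∑ j : Fin N,
      RMP.sqSingularValues (RMP.matProd (fun m => X m ω) (M i.castSucc)) j ^ c i) P ∧
    ((∫ ω, ∏ i : Fin k, ∑ j : Fin N,
      RMP.sqSingularValues (RMP.matProd (fun m => X m ω) (M i.castSucc)) j ^ c i ∂P : ℝ) : ℂ) =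
    RMP.nestedDiffOp k (fun i => (c i : ℂ))
      (fun i z => ∏ m ∈ Finset.Ioc (M i.succ) (M i.castSucc), RMP.besselGenFun P (X m) z)
      (RMP.rho N) := by
  obtain ⟨H, hH, hmom⟩ := RMP.exists_isMoment_nestedDiffOp hmeas hindep hnonsing hinv hexists
    k c M hM hMlast
  have hmoment : (fun ω => H ω * RMP.gramSph (RMP.rho N) (RMP.matProd (fun m => X m ω) (M 0)))
      =ᵐ[P] fun ω => ((∏ i : Fin k, ∑ j : Fin N,
        RMP.sqSingularValues (RMP.matProd (fun m => X m ω) (M i.castSucc)) j ^ c i : ℝ) : ℂ) := by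
    filter_upwards [hH, RMP.ae_isUnit_matProd hnonsing (M 0)] with ω hω hu
    rw [hω, RMP.gramSph, RMP.sph_rho hu, mul_one]
  refine ⟨?_, ?_⟩
  · exact ((hmom.integrable (RMP.rho N)).congr hmoment).re
  · rw [← hmom.integral_eq, integral_congr_ae hmoment, integral_complex_ofReal]
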